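/- **Conventions.** A trigraph $T$ is a finite vertex set $V(T)$ with a function $\theta$ assigning a value in $\{-1,0,1\}$ to every $2$-subset of $V(T)$. Distinct $u,v$ are strongly adjacent, semiadjacent (a switchable pair) or strongly antiadjacent if $\theta(uv)=1,0,-1$ respectively; adjacent means strongly adjacent or semiadjacent, and antiadjacent means strongly antiadjacent or semiadjacent. Disjoint sets are strongly complete (strongly anticomplete) to each other if all pairs between them are strongly adjacent (strongly antiadjacent). The complement $\overline T$ has function $-\theta$; $T|X$ is the restriction of $T$ to $X$. The full realization of $T$ is the graph on $V(T)$ whose edges are the adjacent pairs. A set $X$ (or $T|X$) is connected if the full realization of $T|X$ is connected (the empty set counts as connected), anticonnected if it is connected in $\overline T$; the components of $T|X$ are those of its full realization. A path of length $n$ is a sequence of distinct vertices $p_0,\dots,p_n$ with $p_i,p_j$ adjacent if $|i-j|=1$ and antiadjacent if $|i-j|>1$; its ends are $p_0,p_n$ and its interior is the set of its other vertices. A hole of length $k\ge 4$ is a sequence of distinct vertices $h_1,\dots,h_k$ with $h_i,h_j$ adjacent if $|i-j|\in\{1,k-1\}$ and antiadjacent if $1<|i-j|<k-1$. Antipaths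 and antiholes of $T$ are paths and holes of $\overline T$. $T$ is Berge if it has no odd hole and no odd antihole. **The class $\mathcal F$.** Let $\Sigma(T)$ be the graph on $V(T)$ whose edges are the switchable pairs. $\mathcal F$ is the class of Berge trigraphs $T$ such that every connected component of $\Sigma(T)$ has at most two edges and, for every vertex $v$ of degree two in $\Sigma(T)$ with neighbors $x,y$ there, either $v$ is strongly complete to $V(T)\setminus\{v,x,y\}$ and $x,y$ are strongly adjacent, or $v$ is strongly anticomplete to $V(T)\setminus\{v,x,y\}$ and $x,y$ are strongly antiadjacent. **Balanced skew-partitions.** A skew-partition of $T$ is a partition $(A,B)$ of $V(T)$ such that $A$ is not connected and $B$ is not anticonnected. It is balanced if there is no odd path of length greater than $1$ with ends in $B$ and interior in $A$, and no odd antipath of length greater than $1$ with ends in $A$ and interior in $B$. **2-joins and fragments.** A $2$-join of $T$ is a partition $(X_1,X_2)$ of $V(T)$ for which there are pairwise disjoint sets $A_1,B_1,C_1,A_2,B_2,C_2$ (a split) with $X_i=A_i\cup B_i\cup C_i$; $A_1,A_2,B_1,B_2$ non-empty; no switchable pair between $X_1$ and $X_2$; $A_1$ strongly complete to $A_2$,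 $B_1$ strongly complete to $B_2$, and no other strong edges between $X_1$ and $X_2$; $|X_i|\ge 3$; and, for $i=1,2$, if $|A_i|=|B_i|=1$ then the full realization of $T|X_i$ is not a path of length two joining the members of $A_i$ and $B_i$. It is proper if, for $i=1,2$, every component of $T|X_i$ meets both $A_i$ and $B_i$. If $T$ is Berge, all paths with one end in $A_i$, the other in $B_i$ and interior in $C_i$ ($i=1,2$) of a proper $2$-join have lengths of the same parity; the $2$-join is called odd or even accordingly. A (proper, odd, even) complement $2$-join of $T$, and a split of it, is a (proper, odd, even) $2$-join of $\overline T$, and a split of that. A set $X\subseteq V(T)$ is a fragment of $T$ if $(X,V(T)\setminus X)$ is a proper $2$-join or a proper complement $2$-join of $T$. **Blocks.** Let $X=X_1$ be a fragment, $X_2=V(T)\setminus X$, with split $(A_1,B_1,C_1,A_2,B_2,C_2)$. The block $T_X$ is obtained from $T|X$ by adding new vertices as follows; pairs between a new vertex and $X$ that are not mentioned are strongly antiadjacent. - Odd $2$-join: add $a,b$, with $a$ strongly complete to $A_1$, $b$ strongly complete to $B_1$, and $ab$ switchable. - Even $2$-join: add $a,b,c$, with $a$ strongly complete to $A_1$,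 $b$ strongly complete to $B_1$, $ac$ and $cb$ switchable, and $a,b$ strongly antiadjacent. - Odd complement $2$-join: add $a,b$, with $a$ strongly complete to $B_1\cup C_1$, $b$ strongly complete to $A_1\cup C_1$, and $ab$ switchable. - Even complement $2$-join: add $a,b,c$, with $a$ strongly complete to $B_1\cup C_1$, $b$ strongly complete to $A_1\cup C_1$, $c$ strongly complete to $X$, $ac$ and $cb$ switchable, and $a,b$ strongly adjacent. **Theorem.** Let $T\in\mathcal F$ have no balanced skew-partition, and let $X$ be a fragment of $T$. Then the block of decomposition $T_X$ has no balanced skew-partition. -/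

import Mathlib

universe u v

/-- A trigraph with vertex set `V`. The adjacency function is a symmetric function `θ` of two
vertices with values in `{-1, 0, 1}`. Only its values on pairs of distinct vertices matter; on the
diagonal it is normalised to `0`, and every notion below is about distinct vertices. -/
@[ext]
structure Trigraph (V : Type u) where
  θ : V → V → SignType
  symm : ∀ x y, θ x y = θ y x
  diag : ∀ x, θ x x = 0

namespace Trigraph

section Basic

variable {V : Type u}

def StrongAdj (T : Trigraph V) (x y : V) : Prop := x ≠ y ∧ T.θ x y = 1

def StrongAntiadj (T : Trigraph V) (x y : V) : Prop := x ≠ y ∧ T.θ x y = -1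

/-- `xy` is a switchable pair. -/
def Semiadj (T : Trigraph V) (x y : V) : Prop := x ≠ y ∧ T.θ x y = 0

def Adj (T : Trigraph V) (x y : V) : Prop := T.StrongAdj x y ∨ T.Semiadj x y

def Antiadj (T : Trigraph V) (x y : V) : Prop := T.StrongAntiadj x y ∨ T.Semiadj x y

/-- The complement trigraph. -/
def compl (T : Trigraph V) : Trigraph V where
  θ x y := -T.θ x y
  symm x y := by rw [T.symm x y]
  diag x := by rw [T.diag x]; rfl

/-- The graph in which all adjacent pairs (strongly adjacent or switchable) are edges. -/
def fullRealization (T : Trigraph V) : SimpleGraph V where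
  Adj := T.Adj
  symm := ⟨fun x y h => by
    rcases h with h | h
    · exact Or.inl ⟨h.1.symm, by rw [T.symm y x]; exact h.2⟩
    · exact Or.inr ⟨h.1.symm, by rw [T.symm y x]; exact h.2⟩⟩
  loopless := ⟨fun _ h => h.elim (fun h => h.1 rfl) (fun h => h.1 rfl)⟩

/-- The graph `Σ(T)` whose edges are the switchable pairs; its connected components are the
switchable components of `T`. -/
def switchableGraph (T : Trigraph V) : SimpleGraph V where
  Adj := T.Semiadj
  symm := ⟨fun x y h => ⟨h.1.symm, by rw [T.symm y x]; exact h.2⟩⟩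
  loopless := ⟨fun _ h => h.1 rfl⟩

/-- `T|X` is connected. The empty set counts as connected. -/
def IsConnected (T : Trigraph V) (X : Set V) : Prop :=
  (T.fullRealization.induce X).Preconnected

/-- `T|X` is anticonnected. -/
def IsAnticonnected (T : Trigraph V) (X : Set V) : Prop :=
  T.compl.IsConnected X

/-- The sequence `p 0, …, p n` is a path of `T`; its length is `n`. -/
structure IsPath (T : Trigraph V) {n : ℕ} (p : Fin (n + 1) → V) : Prop where
  injective : Function.Injective p
  adj : ∀ i j : Fin (n + 1), (i : ℕ) + 1 = j → T.Adj (p i) (p j)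
  antiadj : ∀ i j : Fin (n + 1), (i : ℕ) + 1 < j → T.Antiadj (p i) (p j)

/-- An antipath of `T` is a path of the complement. -/
def IsAntipath (T : Trigraph V) {n : ℕ} (p : Fin (n + 1) → V) : Prop :=
  T.compl.IsPath p

/-- The vertices `h 0, …, h (k - 1)`, in this cyclic order, form a hole of length `k`. -/
structure IsHole (T : Trigraph V) {k : ℕ} (h : Fin k → V) : Prop where
  four_le : 4 ≤ k
  injective : Function.Injective h
  adj : ∀ i j : Fin k, (i : ℕ) + 1 = j ∨ (i : ℕ) + (k - 1) = j → T.Adj (h i) (h j)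
  antiadj : ∀ i j : Fin k, (i : ℕ) + 1 < j → (j : ℕ) < i + (k - 1) → T.Antiadj (h i) (h j)

/-- An antihole of `T` is a hole of the complement. -/
def IsAntihole (T : Trigraph V) {k : ℕ} (h : Fin k → V) : Prop :=
  T.compl.IsHole h

/-- No odd hole and no odd antihole. -/
def IsBerge (T : Trigraph V) : Prop :=
  ∀ (k : ℕ) (h : Fin k → V), Odd k → ¬ T.IsHole h ∧ ¬ T.IsAntihole h

/-- The vertex `v` of degree two in `Σ(T)`, with neighbours `x`, `y` there, is heavy. -/
def IsHeavy (T : Trigraph V) (v x y : V) : Prop :=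
  (∀ w, w ≠ v → w ≠ x → w ≠ y → T.StrongAdj v w) ∧ T.StrongAdj x y

/-- The vertex `v` of degree two in `Σ(T)`, with neighbours `x`, `y` there, is light. -/
def IsLight (T : Trigraph V) (v x y : V) : Prop :=
  (∀ w, w ≠ v → w ≠ x → w ≠ y → T.StrongAntiadj v w) ∧ T.StrongAntiadj x y

/-- The class `𝓕` of Berge trigraphs. -/
structure IsInF (T : Trigraph V) : Prop where
  berge : T.IsBerge
  switchable_component :
    ∀ c : T.switchableGraph.ConnectedComponent, c.toSimpleGraph.edgeSet.encard ≤ 2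
  heavy_or_light : ∀ v x y : V, x ≠ y → T.switchableGraph.neighborSet v = {x, y} →
    T.IsHeavy v x y ∨ T.IsLight v x y

/-- The pair `(A, B)` of disjoint vertex sets is balanced: no odd path of length greater than one
has its ends in `B` and its interior in `A`, and no odd antipath of length greater than one has its
ends in `A` and its interior in `B`. -/
def IsBalancedPair (T : Trigraph V) (A B : Set V) : Prop :=
  (∀ (n : ℕ) (p : Fin (n + 1) → V), T.IsPath p → Odd n → 1 < n →
    ¬ (p 0 ∈ B ∧ p (Fin.last n) ∈ B ∧ ∀ i, i ≠ 0 → i ≠ Fin.last n → p i ∈ A)) ∧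
  (∀ (n : ℕ) (p : Fin (n + 1) → V), T.IsAntipath p → Odd n → 1 < n →
    ¬ (p 0 ∈ A ∧ p (Fin.last n) ∈ A ∧ ∀ i, i ≠ 0 → i ≠ Fin.last n → p i ∈ B))

/-- `(A, B)` is a skew-partition of `T`. -/
structure IsSkewPartition (T : Trigraph V) (A B : Set V) : Prop where
  partition : IsCompl A B
  not_connected : ¬ T.IsConnected A
  not_anticonnected : ¬ T.IsAnticonnected B

def HasBalancedSkewPartition (T : Trigraph V) : Prop :=
  ∃ A B : Set V, T.IsSkewPartition A B ∧ T.IsBalancedPair A B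

end Basic

/-! ### 2-joins -/

/-- Six sets of vertices, the data of a split of a 2-join. -/
structure SplitSets (V : Type u) where
  (A₁ B₁ C₁ A₂ B₂ C₂ : Set V)

section TwoJoin

variable {V : Type u}

/-- `A = {a}`, `B = {b}`, and the full realization of `T|X` is a path of length two from `a` to
`b`. -/
def IsShortPathSide (T : Trigraph V) (X A B : Set V) : Prop :=
  ∃ a b c : V, A = {a} ∧ B = {b} ∧ X = {a, c, b} ∧
    T.fullRealization.Adj a c ∧ T.fullRealization.Adj c b ∧ a ≠ b ∧ ¬ T.fullRealization.Adj a b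

/-- `s` is a split of the 2-join `(X₁, X₂)` of `T`. -/
structure IsSplit (T : Trigraph V) (X₁ X₂ : Set V) (s : SplitSets V) : Prop where
  partition : IsCompl X₁ X₂
  union₁ : X₁ = s.A₁ ∪ s.B₁ ∪ s.C₁
  union₂ : X₂ = s.A₂ ∪ s.B₂ ∪ s.C₂
  disjoint_AB₁ : Disjoint s.A₁ s.B₁
  disjoint_AC₁ : Disjoint s.A₁ s.C₁
  disjoint_BC₁ : Disjoint s.B₁ s.C₁
  disjoint_AB₂ : Disjoint s.A₂ s.B₂
  disjoint_AC₂ : Disjoint s.A₂ s.C₂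
  disjoint_BC₂ : Disjoint s.B₂ s.C₂
  nonempty_A₁ : s.A₁.Nonempty
  nonempty_B₁ : s.B₁.Nonempty
  nonempty_A₂ : s.A₂.Nonempty
  nonempty_B₂ : s.B₂.Nonempty
  no_switchable : ∀ x ∈ X₁, ∀ y ∈ X₂, ¬ T.Semiadj x y
  complete_A : ∀ x ∈ s.A₁, ∀ y ∈ s.A₂, T.StrongAdj x y
  complete_B : ∀ x ∈ s.B₁, ∀ y ∈ s.B₂, T.StrongAdj x y
  no_other : ∀ x ∈ X₁, ∀ y ∈ X₂, T.StrongAdj x y →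
    (x ∈ s.A₁ ∧ y ∈ s.A₂) ∨ (x ∈ s.B₁ ∧ y ∈ s.B₂)
  card₁ : 3 ≤ X₁.encard
  card₂ : 3 ≤ X₂.encard
  not_short₁ : ¬ T.IsShortPathSide X₁ s.A₁ s.B₁
  not_short₂ : ¬ T.IsShortPathSide X₂ s.A₂ s.B₂

/-- Every component of `T|X` meets both `A` and `B`. -/
def ComponentsMeet (T : Trigraph V) (X A B : Set V) : Prop :=
  ∀ c : (T.fullRealization.induce X).ConnectedComponent,
    (∃ x ∈ c.supp, (x : V) ∈ A) ∧ (∃ x ∈ c.supp, (x : V) ∈ B)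

/-- `s` is a split of the proper 2-join `(X₁, X₂)` of `T`. -/
structure IsProperSplit (T : Trigraph V) (X₁ X₂ : Set V) (s : SplitSets V) : Prop
    extends T.IsSplit X₁ X₂ s where
  proper₁ : T.ComponentsMeet X₁ s.A₁ s.B₁
  proper₂ : T.ComponentsMeet X₂ s.A₂ s.B₂

/-- `(X₁, X₂)` is a proper 2-join of `T`. -/
def IsProperTwoJoin (T : Trigraph V) (X₁ X₂ : Set V) : Prop :=
  ∃ s : SplitSets V, T.IsProperSplit X₁ X₂ s

/-- `(X₁, X₂)` is a proper complement 2-join of `T`. -/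
def IsProperComplTwoJoin (T : Trigraph V) (X₁ X₂ : Set V) : Prop :=
  T.compl.IsProperTwoJoin X₁ X₂

/-- `X` is a fragment of `T`. -/
def IsFragment (T : Trigraph V) (X : Set V) : Prop :=
  T.IsProperTwoJoin X Xᶜ ∨ T.IsProperComplTwoJoin X Xᶜ

/-- There is a path of `T` of length `n` with one end in `A`, one end in `B` and interior
in `C`. -/
def HasLinkingPath (T : Trigraph V) (A B C : Set V) (n : ℕ) : Prop :=
  ∃ p : Fin (n + 1) → V, T.IsPath p ∧ p 0 ∈ A ∧ p (Fin.last n) ∈ B ∧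
    ∀ i, i ≠ 0 → i ≠ Fin.last n → p i ∈ C

/-- `n` is the length of a path from `Aᵢ` to `Bᵢ` with interior in `Cᵢ`, for `i = 1` or `i = 2`.
For a proper 2-join of a Berge trigraph such paths exist on both sides and all their lengths have
the same parity. -/
def IsLinkingLength (T : Trigraph V) (s : SplitSets V) (n : ℕ) : Prop :=
  T.HasLinkingPath s.A₁ s.B₁ s.C₁ n ∨ T.HasLinkingPath s.A₂ s.B₂ s.C₂ n

/-- The 2-join of `T` with split `s` is odd: its linking paths have odd length. The parity being
common to all of them (in a Berge trigraph), it is read off from any one. -/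
def IsOddSplit (T : Trigraph V) (s : SplitSets V) : Prop :=
  ∃ n, T.IsLinkingLength s n ∧ Odd n

/-- The 2-join of `T` with split `s` is even. -/
def IsEvenSplit (T : Trigraph V) (s : SplitSets V) : Prop :=
  ∃ n, T.IsLinkingLength s n ∧ Even n

end TwoJoin

/-! ### Blocks of decomposition -/

/-- The markers `a`, `b` of an odd block. -/
inductive OddMarker : Type
  | a
  | b

/-- The markers `a`, `b`, `c` of an even block. -/
inductive EvenMarker : Type
  | a
  | b
  | c

/-- The marker component of an odd block: `ab` is a switchable pair. -/
def oddMarkers : Trigraph OddMarker where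
  θ _ _ := 0
  symm _ _ := rfl
  diag _ := rfl

/-- The marker component of an even block: `ac`, `cb` are switchable pairs and `ab` has the
value `ε`. -/
def evenMarkers (ε : SignType) : Trigraph EvenMarker where
  θ
    | .a, .b => ε
    | .b, .a => ε
    | _, _ => 0
  symm x y := by cases x <;> cases y <;> rfl
  diag x := by cases x <;> rfl

section Block

variable {V : Type u} {M : Type v}

open Classical in
/-- The trigraph obtained from `T|X` by adding the trigraph `K` of new vertices, where the marker
`m` is strongly complete to `X ∩ N m` and strongly anticomplete to `X \ N m`. -/
noncomputable def addMarkers (T : Trigraph V) (X : Set V) (K : Trigraph M) (N : M → Set V) :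
    Trigraph (X ⊕ M) where
  θ
    | .inl x, .inl y => T.θ x y
    | .inl x, .inr m => if (x : V) ∈ N m then 1 else -1
    | .inr m, .inl x => if (x : V) ∈ N m then 1 else -1
    | .inr m, .inr m' => K.θ m m'
  symm x y := by
    rcases x with x | x <;> rcases y with y | y
    · exact T.symm x y
    · rfl
    · rfl
    · exact K.symm x y
  diag x := by
    rcases x with x | x
    · exact T.diag x
    · exact K.diag x

/-- The block with respect to `X = X₁` of an odd 2-join of `T` with split `s`. -/
noncomputable def oddBlock (T : Trigraph V) (X : Set V) (s : SplitSets V) :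
    Trigraph (X ⊕ OddMarker) :=
  T.addMarkers X oddMarkers fun
    | .a => s.A₁
    | .b => s.B₁

/-- The block with respect to `X = X₁` of an even 2-join of `T` with split `s`. -/
noncomputable def evenBlock (T : Trigraph V) (X : Set V) (s : SplitSets V) :
    Trigraph (X ⊕ EvenMarker) :=
  T.addMarkers X (evenMarkers (-1)) fun
    | .a => s.A₁
    | .b => s.B₁
    | .c => ∅

/-- The block with respect to `X = X₁` of an odd complement 2-join of `T` with split `s`. -/
noncomputable def oddComplBlock (T : Trigraph V) (X : Set V) (s : SplitSets V) :
    Trigraph (X ⊕ OddMarker) :=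
  T.addMarkers X oddMarkers fun
    | .a => s.B₁ ∪ s.C₁
    | .b => s.A₁ ∪ s.C₁

/-- The block with respect to `X = X₁` of an even complement 2-join of `T` with split `s`. -/
noncomputable def evenComplBlock (T : Trigraph V) (X : Set V) (s : SplitSets V) :
    Trigraph (X ⊕ EvenMarker) :=
  T.addMarkers X (evenMarkers 1) fun
    | .a => s.B₁ ∪ s.C₁
    | .b => s.A₁ ∪ s.C₁
    | .c => X

/-- `T'` is a block of decomposition `T_X` of `T` with respect to the fragment `X`: it is built from
some split of a proper 2-join or proper complement 2-join `(X, V(T) \ X)`, according to its parity.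
A split of a complement 2-join of `T` is a split of the 2-join of the complement, and its parity is
taken in the complement. -/
inductive IsBlock (T : Trigraph V) (X : Set V) : {W : Type u} → Trigraph W → Prop
  | odd (s : SplitSets V) : T.IsProperSplit X Xᶜ s → T.IsOddSplit s →
      IsBlock T X (T.oddBlock X s)
  | even (s : SplitSets V) : T.IsProperSplit X Xᶜ s → T.IsEvenSplit s →
      IsBlock T X (T.evenBlock X s)
  | oddCompl (s : SplitSets V) : T.compl.IsProperSplit X Xᶜ s → T.compl.IsOddSplit s →
      IsBlock T X (T.oddComplBlock X s)
  | evenCompl (s : SplitSets V) : T.compl.IsProperSplit X Xᶜ s → T.compl.IsEvenSplit s →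
      IsBlock T X (T.evenComplBlock X s)

end Block

end Trigraph

/-! The contrapositive is proved: a balanced skew-partition of a block is turned into one of `T`.
Complementation exchanges the two sides of a skew-partition and turns blocks of complement 2-joins
into blocks of 2-joins of the complement, so only the latter need treatment.

Let `(A, B)` be a balanced skew-partition of such a block. If all markers are in `A`, they lie in
one part of it, and everything outside `X` can replace them. If exactly one marker is in `B`, it is
attached to an end of the join; the opposite end outside `X` takes its place in `B` and the rest
outside `X` goes to `A`. No other distribution is possible. So `T` has a skew-partition. Paths and
antipaths through the new vertices might destroy balance, but one part of `A` and one part of `B`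
avoid the markers and form a balanced pair in `T`.

Such a pair is enough (`hasBalancedSkewPartition_of_isBalancedPair`): vertices are moved between the
sides until the whole partition is balanced. Balance spreads from an anticonnected set `B` to a set
`C` complete to it by `IsBalancedPair.of_complete`. This rests on a form of the Roussel–Rubio lemma,
`IsPathSeq.eq_one_of_complete_ends`, proved by induction on the anticonnected set and by counting,
modulo two, the edges of the path with both ends complete to a subset. -/

namespace Trigraph

/-! ### Adjacency and complementation -/

section Adjacency

variable {V : Type u} {T : Trigraph V} {x y : V}

theorem compl_compl (T : Trigraph V) : T.compl.compl = T := by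
  ext x y
  simp [compl]

theorem compl_strongAdj : T.compl.StrongAdj x y ↔ T.StrongAntiadj x y := by
  simp [StrongAdj, StrongAntiadj, compl, neg_eq_iff_eq_neg]

theorem compl_strongAntiadj : T.compl.StrongAntiadj x y ↔ T.StrongAdj x y := by
  simp [StrongAdj, StrongAntiadj, compl]

theorem compl_semiadj : T.compl.Semiadj x y ↔ T.Semiadj x y := by
  simp [Semiadj, compl]

theorem compl_adj : T.compl.Adj x y ↔ T.Antiadj x y := by
  simp [Adj, Antiadj, compl_strongAdj, compl_semiadj]

theorem compl_antiadj : T.compl.Antiadj x y ↔ T.Adj x y := by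
  simp [Adj, Antiadj, compl_strongAntiadj, compl_semiadj]

theorem StrongAdj.symm (h : T.StrongAdj x y) : T.StrongAdj y x :=
  ⟨h.1.symm, T.symm x y ▸ h.2⟩

theorem StrongAntiadj.symm (h : T.StrongAntiadj x y) : T.StrongAntiadj y x :=
  ⟨h.1.symm, T.symm x y ▸ h.2⟩

theorem Semiadj.symm (h : T.Semiadj x y) : T.Semiadj y x :=
  ⟨h.1.symm, T.symm x y ▸ h.2⟩

theorem Adj.symm (h : T.Adj x y) : T.Adj y x :=
  h.imp StrongAdj.symm Semiadj.symm

theorem Antiadj.symm (h : T.Antiadj x y) : T.Antiadj y x :=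
  h.imp StrongAntiadj.symm Semiadj.symm

theorem StrongAdj.adj (h : T.StrongAdj x y) : T.Adj x y := Or.inl h

theorem StrongAntiadj.antiadj (h : T.StrongAntiadj x y) : T.Antiadj x y := Or.inl h

theorem Semiadj.adj (h : T.Semiadj x y) : T.Adj x y := Or.inr h

theorem Semiadj.antiadj (h : T.Semiadj x y) : T.Antiadj x y := Or.inr h

theorem Adj.ne (h : T.Adj x y) : x ≠ y := h.elim (·.1) (·.1)

theorem Antiadj.ne (h : T.Antiadj x y) : x ≠ y := h.elim (·.1) (·.1)

theorem not_strongAdj_iff (h : x ≠ y) : ¬ T.StrongAdj x y ↔ T.Antiadj x y := by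
  simp only [StrongAdj, Antiadj, StrongAntiadj, Semiadj, h, ne_eq, not_false_eq_true, true_and]
  rcases T.θ x y <;> decide

theorem not_strongAntiadj_iff (h : x ≠ y) : ¬ T.StrongAntiadj x y ↔ T.Adj x y := by
  simp only [StrongAdj, Adj, StrongAntiadj, Semiadj, h, ne_eq, not_false_eq_true, true_and]
  rcases T.θ x y <;> decide

theorem Antiadj.not_strongAdj (h : T.Antiadj x y) : ¬ T.StrongAdj x y :=
  (not_strongAdj_iff h.ne).2 h

theorem Adj.not_strongAntiadj (h : T.Adj x y) : ¬ T.StrongAntiadj x y :=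
  (not_strongAntiadj_iff h.ne).2 h

theorem not_adj_iff (h : x ≠ y) : ¬ T.Adj x y ↔ T.StrongAntiadj x y := by
  rw [← not_strongAntiadj_iff h, not_not]

end Adjacency

/-! ### Paths and holes as sequences indexed by natural numbers -/

section Sequences

variable {V : Type u} {T : Trigraph V} {p q : ℕ → V} {n m : ℕ} {x : V}

/-- `p 0, …, p n` is a path of `T`. -/
def IsPathSeq (T : Trigraph V) (p : ℕ → V) (n : ℕ) : Prop :=
  (∀ i, i < n → T.Adj (p i) (p (i + 1))) ∧ ∀ i j, i + 1 < j → j ≤ n → T.Antiadj (p i) (p j)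

/-- `h 0, …, h (k - 1)` is a hole of `T`. -/
def IsHoleSeq (T : Trigraph V) (h : ℕ → V) (k : ℕ) : Prop :=
  4 ≤ k ∧ (∀ i, i + 1 < k → T.Adj (h i) (h (i + 1))) ∧ T.Adj (h 0) (h (k - 1)) ∧
    ∀ i j, i + 1 < j → j < i + (k - 1) → j < k → T.Antiadj (h i) (h j)

theorem IsPathSeq.ne (hp : T.IsPathSeq p n) {i j : ℕ} (hij : i < j) (hj : j ≤ n) :
    p i ≠ p j := by
  rcases Nat.lt_or_ge (i + 1) j with h | h
  · exact (hp.2 i j h hj).ne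
  · obtain rfl : j = i + 1 := by omega
    exact (hp.1 i (by omega)).ne

theorem IsPathSeq.isPath (hp : T.IsPathSeq p n) : T.IsPath fun i : Fin (n + 1) => p i where
  injective := by
    intro i j h
    rcases lt_trichotomy (i : ℕ) j with h' | h' | h'
    · exact (hp.ne h' (by omega) h).elim
    · exact Fin.ext h'
    · exact (hp.ne h' (by omega) h.symm).elim
  adj := by
    intro i j h
    have := hp.1 i (by omega)
    rwa [h] at this
  antiadj i j h := hp.2 i j h (by omega)

/-- Beyond `n` the indices wrap around; these values never matter. -/
theorem IsPath.isPathSeq {p : Fin (n + 1) → V} (hp : T.IsPath p) :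
    T.IsPathSeq (fun i => p (Fin.ofNat (n + 1) i)) n := by
  have hval : ∀ i, i ≤ n → ((Fin.ofNat (n + 1) i : Fin (n + 1)) : ℕ) = i := fun i hi => by
    simp [Fin.ofNat, Nat.mod_eq_of_lt (Nat.lt_succ_of_le hi)]
  refine ⟨fun i hi => hp.adj _ _ ?_, fun i j hij hj => hp.antiadj _ _ ?_⟩
  · rw [hval i (by omega), hval (i + 1) (by omega)]
  · rw [hval i (by omega), hval j (by omega)]; exact hij

theorem IsHoleSeq.isHole {h : ℕ → V} {k : ℕ} (hh : T.IsHoleSeq h k) :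
    T.IsHole fun i : Fin k => h i := by
  obtain ⟨h4, hadj, hclose, hanti⟩ := hh
  have hne : ∀ i j, i < j → j < k → h i ≠ h j := by
    intro i j hij hj
    by_cases h1 : i + 1 = j
    · subst h1; exact (hadj i hj).ne
    · by_cases h2 : j < i + (k - 1)
      · exact (hanti i j (by omega) h2 hj).ne
      · obtain rfl : i = 0 := by omega
        obtain rfl : j = k - 1 := by omega
        exact hclose.ne
  refine ⟨h4, ?_, ?_, fun i j h1 h2 => hanti i j h1 h2 j.2⟩
  · intro i j hij
    rcases lt_trichotomy (i : ℕ) j with h' | h' | h'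
    · exact (hne i j h' j.2 hij).elim
    · exact Fin.ext h'
    · exact (hne j i h' i.2 hij.symm).elim
  · rintro i j (h1 | h1)
    · have := hadj i (by omega)
      rwa [h1] at this
    · have h0 : (i : ℕ) = 0 := by omega
      have h2 : (j : ℕ) = k - 1 := by omega
      simpa only [h0, h2] using hclose

theorem IsBerge.not_hole (hT : T.IsBerge) {h : ℕ → V} {k : ℕ} (hh : T.IsHoleSeq h k)
    (hk : Odd k) : False :=
  (hT k _ hk).1 hh.isHole

theorem IsBerge.compl (hT : T.IsBerge) : T.compl.IsBerge := by
  intro k h hk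
  refine ⟨(hT k h hk).2, ?_⟩
  unfold IsAntihole
  rw [compl_compl]
  exact (hT k h hk).1

theorem IsPathSeq.take (hp : T.IsPathSeq p n) (hm : m ≤ n) : T.IsPathSeq p m :=
  ⟨fun i hi => hp.1 i (by omega), fun i j h1 h2 => hp.2 i j h1 (by omega)⟩

theorem IsPathSeq.shift (hp : T.IsPathSeq p n) {a b : ℕ} (hb : b ≤ n) :
    T.IsPathSeq (fun i => p (a + i)) (b - a) :=
  ⟨fun i hi => hp.1 (a + i) (by omega), fun i j h1 h2 => hp.2 (a + i) (a + j) (by omega) (by omega)⟩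

theorem IsPathSeq.reverse (hp : T.IsPathSeq p n) : T.IsPathSeq (fun i => p (n - i)) n := by
  refine ⟨fun i hi => ?_, fun i j h1 h2 => (hp.2 _ _ (by omega) (by omega)).symm⟩
  have := (hp.1 (n - (i + 1)) (by omega)).symm
  rwa [show n - (i + 1) + 1 = n - i by omega] at this

/-- `p 0, …, p n, x`. -/
def snocSeq (p : ℕ → V) (n : ℕ) (x : V) (i : ℕ) : V := if i ≤ n then p i else x

theorem snocSeq_of_le {i : ℕ} (h : i ≤ n) : snocSeq p n x i = p i := if_pos h

theorem snocSeq_of_lt {i : ℕ} (h : n < i) : snocSeq p n x i = x := if_neg (by omega)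

theorem IsPathSeq.snoc (hp : T.IsPathSeq p n) (h : T.Adj (p n) x)
    (h' : ∀ i, i < n → T.Antiadj (p i) x) : T.IsPathSeq (snocSeq p n x) (n + 1) := by
  refine ⟨fun i hi => ?_, fun i j h1 h2 => ?_⟩
  · rw [snocSeq_of_le (by omega)]
    rcases Nat.lt_or_ge i n with hi' | hi'
    · rw [snocSeq_of_le (by omega)]; exact hp.1 i hi'
    · obtain rfl : i = n := by omega
      rw [snocSeq_of_lt (by omega)]; exact h
  · rw [snocSeq_of_le (by omega)]
    rcases Nat.lt_or_ge n j with hj | hj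
    · rw [snocSeq_of_lt hj]; exact h' i (by omega)
    · rw [snocSeq_of_le hj]; exact hp.2 i j h1 hj

/-- A path together with a vertex adjacent to its ends and antiadjacent to its interior is a
hole. -/
theorem IsPathSeq.hole (hp : T.IsPathSeq p n) (hn : 2 ≤ n) (h0 : T.Adj (p 0) x)
    (hx : T.Adj (p n) x) (h' : ∀ i, 0 < i → i < n → T.Antiadj (p i) x) :
    T.IsHoleSeq (snocSeq p n x) (n + 2) := by
  refine ⟨by omega, fun i hi => ?_, ?_, fun i j h1 h2 h3 => ?_⟩
  · rw [snocSeq_of_le (by omega)]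
    rcases Nat.lt_or_ge i n with hi' | hi'
    · rw [snocSeq_of_le (by omega)]; exact hp.1 i hi'
    · obtain rfl : i = n := by omega
      rw [snocSeq_of_lt (by omega)]; exact hx
  · rw [snocSeq_of_le (by omega), snocSeq_of_lt (by omega)]; exact h0
  · rw [snocSeq_of_le (by omega)]
    rcases Nat.lt_or_ge n j with hj | hj
    · rw [snocSeq_of_lt hj]; exact h' i (by omega) (by omega)
    · rw [snocSeq_of_le hj]; exact hp.2 i j h1 hj

/-- Two paths with common ends and mutually antiadjacent interiors form a hole. -/
theorem IsPathSeq.union_hole (hp : T.IsPathSeq p n) (hq : T.IsPathSeq q m) (hn : 2 ≤ n)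
    (hm : 2 ≤ m) (h0 : p 0 = q 0) (h1 : p n = q m)
    (h : ∀ i j, 0 < i → i < n → 0 < j → j < m → T.Antiadj (p i) (q j)) :
    T.IsHoleSeq (fun i => if i ≤ n then p i else q (n + m - i)) (n + m) := by
  refine ⟨by omega, fun i hi => ?_, ?_, fun i j hij hj hk => ?_⟩
  · dsimp only
    rcases lt_trichotomy i n with hi' | rfl | hi'
    · rw [if_pos (by omega), if_pos (by omega)]; exact hp.1 i hi'
    -- The second path is traversed backwards, so the cycle passes from `p n = q m` to `q (m - 1)`.
    · rw [if_pos le_rfl, if_neg (by omega), h1, show i + m - (i + 1) = m - 1 by omega]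
      have := (hq.1 (m - 1) (by omega)).symm
      rwa [show m - 1 + 1 = m by omega] at this
    · rw [if_neg (by omega), if_neg (by omega)]
      have := (hq.1 (n + m - (i + 1)) (by omega)).symm
      rwa [show n + m - (i + 1) + 1 = n + m - i by omega] at this
  · dsimp only
    rw [if_pos (by omega), if_neg (by omega), h0, show n + m - (n + m - 1) = 0 + 1 by omega]
    exact hq.1 0 (by omega)
  · dsimp only
    by_cases hjn : j ≤ n
    · rw [if_pos (by omega), if_pos hjn]; exact hp.2 i j hij hjn
    · rw [if_neg hjn]
      rcases lt_trichotomy i n with hi' | rfl | hi'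
      · rw [if_pos (by omega)]
        rcases Nat.eq_zero_or_pos i with rfl | hi0
        · rw [h0]; exact hq.2 _ _ (by omega) (by omega)
        · exact h _ _ hi0 hi' (by omega) (by omega)
      · rw [if_pos le_rfl, h1]; exact (hq.2 _ _ (by omega) (by omega)).symm
      · rw [if_neg (by omega)]; exact (hq.2 _ _ (by omega) (by omega)).symm

end Sequences

/-! ### Connectivity, induced paths and non-cut vertices -/

section Connectivity

variable {V : Type u} {T : Trigraph V} {S : Set V}

/-- `S` is connected: it is not the union of two non-empty sets strongly anticomplete to each
other. -/
def CutConnected (T : Trigraph V) (S : Set V) : Prop :=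
  ∀ U ⊆ S, U.Nonempty → (∀ u ∈ U, ∀ w ∈ S, w ∉ U → ¬ T.Adj u w) → U = S

theorem isConnected_iff_cutConnected : T.IsConnected S ↔ T.CutConnected S := by
  constructor
  · intro h U hU ⟨u, hu⟩ hcut
    refine Set.Subset.antisymm hU fun w hw => ?_
    obtain ⟨q⟩ := h ⟨u, hU hu⟩ ⟨w, hw⟩
    suffices H : ∀ (a b : S), (T.fullRealization.induce S).Walk a b → (a : V) ∈ U → (b : V) ∈ U from
      H _ _ q hu
    intro a b q
    induction q with
    | nil => exact id
    | cons hadj _ ih =>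
      intro ha
      refine ih ?_
      by_contra hb
      exact hcut _ ha _ (Subtype.coe_prop _) hb hadj
  · intro h x y
    -- No edge leaves the set of vertices reachable from `x`.
    have := h {z | ∃ hz : z ∈ S, (T.fullRealization.induce S).Reachable x ⟨z, hz⟩}
      (fun z hz => hz.1) ⟨x, x.2, SimpleGraph.Reachable.refl _⟩ ?_
    · obtain ⟨_, hy⟩ := this.ge y.2
      exact hy
    · rintro u ⟨huS, hu⟩ w hwS hw hadj
      exact hw ⟨hwS, hu.trans (SimpleGraph.Adj.reachable (by exact hadj))⟩

theorem exists_cut_of_not_isConnected (h : ¬ T.IsConnected S) :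
    ∃ U W, U ∪ W = S ∧ U.Nonempty ∧ W.Nonempty ∧ ∀ u ∈ U, ∀ w ∈ W, T.StrongAntiadj u w := by
  rw [isConnected_iff_cutConnected, CutConnected] at h
  push Not at h
  obtain ⟨U, hU, hne, hcut, hUS⟩ := h
  refine ⟨U, S \ U, Set.union_sdiff_cancel hU, hne, ?_, fun u hu w hw => ?_⟩
  · rw [Set.nonempty_iff_ne_empty]
    intro h0
    exact hUS (Set.Subset.antisymm hU (Set.sdiff_eq_empty.1 h0))
  · exact (not_adj_iff (by rintro rfl; exact hw.2 hu)).1 (hcut u hu w hw.1 hw.2)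

theorem not_isConnected_union {U W : Set V} (hU : U.Nonempty) (hW : W.Nonempty)
    (h : ∀ u ∈ U, ∀ w ∈ W, T.StrongAntiadj u w) : ¬ T.IsConnected (U ∪ W) := by
  rw [isConnected_iff_cutConnected]
  intro hc
  obtain ⟨w, hw⟩ := hW
  have := hc U Set.subset_union_left hU fun u hu w hw hwU hadj =>
    hadj.not_strongAntiadj (h u hu w (hw.resolve_left hwU))
  have hwU : w ∈ U := this ▸ Or.inr hw
  exact (h w hwU w hw).1 rfl

theorem CutConnected.insert_of_adj {R : Set V} (hR : T.CutConnected R) {r w : V} (hr : r ∈ R)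
    (hadj : T.Adj r w) : T.CutConnected (insert w R) := by
  intro U hU hne hcut
  have key : r ∈ U → U = insert w R := by
    intro hrU
    have h1 : U ∩ R = R := hR _ Set.inter_subset_right ⟨r, hrU, hr⟩ fun u hu v hv hvU =>
      hcut u hu.1 v (Or.inr hv) fun h => hvU ⟨h, hv⟩
    have h2 : w ∈ U := by
      by_contra hw
      exact hcut r hrU w (Or.inl rfl) hw hadj
    refine Set.Subset.antisymm hU ?_
    rintro z (rfl | hz)
    · exact h2
    · rw [← h1] at hz; exact hz.1
  by_cases hrU : r ∈ U
  · exact key hrU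
  · have hw : w ∉ U := fun hw => hcut w hw r (Or.inr hr) hrU hadj.symm
    obtain ⟨u, hu⟩ := hne
    have h1 : U = R := hR U (fun z hz => (hU hz).resolve_left fun h => hw (h ▸ hz)) ⟨u, hu⟩
      fun u hu v hv hvU => hcut u hu v (Or.inr hv) hvU
    exact (hrU (h1 ▸ hr)).elim

theorem CutConnected.union {R R' : Set V} (hR : T.CutConnected R) (hR' : T.CutConnected R')
    {c : V} (hc : c ∈ R) (hc' : c ∈ R') : T.CutConnected (R ∪ R') := by
  intro U hU hne hcut
  have key : ∀ Q : Set V, T.CutConnected Q → Q ⊆ R ∪ R' → (U ∩ Q).Nonempty → Q ⊆ U := by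
    intro Q hQ hsub hUQ
    have : U ∩ Q = Q := hQ _ Set.inter_subset_right hUQ fun u hu v hv hvU =>
      hcut u hu.1 v (hsub hv) fun h => hvU ⟨h, hv⟩
    exact Set.inter_eq_right.1 this
  have hcU : c ∈ U := by
    obtain ⟨u, hu⟩ := hne
    rcases hU hu with h | h
    · exact key R hR Set.subset_union_left ⟨u, hu, h⟩ hc
    · exact key R' hR' Set.subset_union_right ⟨u, hu, h⟩ hc'
  exact Set.Subset.antisymm hU (Set.union_subset (key R hR Set.subset_union_left ⟨c, hcU, hc⟩)
    (key R' hR' Set.subset_union_right ⟨c, hcU, hc'⟩))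

theorem cutConnected_singleton (x : V) : T.CutConnected {x} := fun _ hU hne _ =>
  (Set.subset_singleton_iff_eq.1 hU).resolve_left hne.ne_empty

/-- A component of `S`. -/
theorem exists_component [Finite V] (hS : S.Nonempty) :
    ∃ D ⊆ S, D.Nonempty ∧ T.CutConnected D ∧ ∀ u ∈ D, ∀ w ∈ S \ D, T.StrongAntiadj u w := by
  -- A component is a minimal non-empty subset strongly anticomplete to the rest of `S`; a cut of it
  -- would give a smaller one.
  obtain ⟨D, hD, hmin⟩ := (Set.toFinite {D : Set V | D ⊆ S ∧ D.Nonempty ∧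
    ∀ u ∈ D, ∀ w ∈ S \ D, T.StrongAntiadj u w}).exists_minimal
      ⟨S, subset_rfl, hS, fun u _ w hw => (hw.2 hw.1).elim⟩
  refine ⟨D, hD.1, hD.2.1, fun U hU hne hcut => ?_, hD.2.2⟩
  refine Set.Subset.antisymm hU (hmin ⟨hU.trans hD.1, hne, fun u hu w hw => ?_⟩ hU)
  by_cases hwD : w ∈ D
  · exact (not_adj_iff (by rintro rfl; exact hw.2 hu)).1 (hcut u hu w hwD hw.2)
  · exact hD.2.2 u (hU hu) w ⟨hw.1, hwD⟩

/-- A connected set has a non-cut vertex different from any given one. -/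
theorem CutConnected.exists_diff_singleton [Finite V] (hS : T.CutConnected S) {x : V} (hx : x ∈ S)
    (hne : S ≠ {x}) : ∃ y ∈ S, y ≠ x ∧ T.CutConnected (S \ {y}) := by
  -- A maximal proper connected subset containing `x` misses just one vertex, since adding an
  -- outside neighbour keeps it connected.
  obtain ⟨R, ⟨hxR, hRS, hR, hRne⟩, hmax⟩ := (Set.toFinite {R : Set V | x ∈ R ∧ R ⊆ S ∧
    T.CutConnected R ∧ R ≠ S}).exists_maximal ⟨{x}, rfl, Set.singleton_subset_iff.2 hx,
      cutConnected_singleton x, hne.symm⟩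
  obtain ⟨r, hr, w, hw, hwR, hadj⟩ : ∃ r ∈ R, ∃ w ∈ S, w ∉ R ∧ T.Adj r w := by
    by_contra! h
    exact hRne (hS R hRS ⟨x, hxR⟩ h)
  have hins : insert w R = S := by
    by_contra hne'
    exact hwR (hmax ⟨Or.inr hxR, Set.insert_subset hw hRS, hR.insert_of_adj hr hadj, hne'⟩
      (Set.subset_insert w R) (Set.mem_insert w R))
  refine ⟨w, hw, fun h => hwR (h ▸ hxR), ?_⟩
  rwa [← hins, Set.insert_sdiff_self_of_notMem hwR]

theorem CutConnected.exists_path (hS : T.CutConnected S) {x y : V} (hx : x ∈ S) (hy : y ∈ S) :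
    ∃ (p : ℕ → V) (n : ℕ), T.IsPathSeq p n ∧ p 0 = x ∧ p n = y ∧ ∀ i ≤ n, p i ∈ S := by
  classical
  -- The set of vertices reached from `x` by paths has no edge leaving it: a path with a neighbour
  -- `w` outside is cut at its first vertex adjacent to `w` and continued to `w`.
  have := hS {z | z ∈ S ∧ ∃ (p : ℕ → V) (n : ℕ), T.IsPathSeq p n ∧ p 0 = x ∧ p n = z ∧
    ∀ i ≤ n, p i ∈ S} (fun z hz => hz.1) ⟨x, hx, fun _ => x, 0, ⟨fun i hi => by omega,
      fun i j h1 h2 => by omega⟩, rfl, rfl, fun _ _ => hx⟩ ?_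
  · rw [← this] at hy
    exact hy.2
  rintro u ⟨huS, p, n, hp, h0, hn, hpS⟩ w hwS hw hadj
  have hex : ∃ i, i ≤ n ∧ T.Adj (p i) w := ⟨n, le_rfl, hn ▸ hadj⟩
  obtain ⟨hi, hiw⟩ := Nat.find_spec hex
  have hmin : ∀ j, j < Nat.find hex → ¬ T.Adj (p j) w := fun j hj h =>
    Nat.find_min hex hj ⟨by omega, h⟩
  have hne : ∀ j, j ≤ n → p j ≠ w := fun j hj h =>
    hw ⟨hwS, p, j, hp.take hj, h0, h, fun k hk => hpS k (by omega)⟩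
  refine hw ⟨hwS, snocSeq p (Nat.find hex) w, Nat.find hex + 1, (hp.take hi).snoc hiw
    fun j hj => ((not_adj_iff (hne j (by omega))).1 (hmin j hj)).antiadj, ?_, ?_, ?_⟩
  · rw [snocSeq_of_le (by omega), h0]
  · rw [snocSeq_of_lt (by omega)]
  · intro j hj
    rcases Nat.lt_or_ge (Nat.find hex) j with h | h
    · rw [snocSeq_of_lt h]; exact hwS
    · rw [snocSeq_of_le h]; exact hpS j (by omega)

/-- Two antiadjacent vertices with neighbours in a connected set are joined by a path of length at
least two through this set. -/
theorem CutConnected.exists_path_through (hS : T.CutConnected S) {u v s t : V} (huS : u ∉ S)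
    (hvS : v ∉ S) (huv : T.Antiadj u v) (hs : s ∈ S) (hus : T.Adj u s) (ht : t ∈ S)
    (hvt : T.Adj v t) : ∃ (p : ℕ → V) (n : ℕ), T.IsPathSeq p n ∧ 2 ≤ n ∧ p 0 = u ∧ p n = v ∧
      ∀ i, 0 < i → i < n → p i ∈ S := by
  classical
  obtain ⟨p, n, hp, h0, hn, hpS⟩ := (hS.insert_of_adj hs hus.symm).exists_path (Set.mem_insert u S)
    (Set.mem_insert_of_mem u ht)
  have hn0 : n ≠ 0 := by
    rintro rfl
    exact huS (h0 ▸ hn ▸ ht)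
  -- Index zero is excluded because `u` and `v` may form a switchable pair, hence be adjacent as
  -- well as antiadjacent.
  have hex : ∃ i, 0 < i ∧ i ≤ n ∧ T.Adj (p i) v := ⟨n, by omega, le_rfl, hn ▸ hvt.symm⟩
  obtain ⟨hi0, hi, hiv⟩ := Nat.find_spec hex
  have hpS' : ∀ j, 0 < j → j ≤ n → p j ∈ S := fun j hj hjn =>
    (hpS j hjn).resolve_left fun h => hp.ne hj hjn (h0.trans h.symm)
  have hmin : ∀ j, j < Nat.find hex → T.Antiadj (p j) v := by
    intro j hj
    rcases Nat.eq_zero_or_pos j with rfl | hj0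
    · rw [h0]; exact huv
    · have hjS := hpS' j hj0 (by omega)
      exact ((not_adj_iff (by rintro rfl; exact hvS hjS)).1 fun h =>
        Nat.find_min hex hj ⟨hj0, by omega, h⟩).antiadj
  refine ⟨snocSeq p (Nat.find hex) v, Nat.find hex + 1, (hp.take hi).snoc hiv hmin, by omega,
    ?_, ?_, ?_⟩
  · rw [snocSeq_of_le (by omega), h0]
  · rw [snocSeq_of_lt (by omega)]
  · intro j hj0 hj
    rw [snocSeq_of_le (by omega)]; exact hpS' j hj0 (by omega)

/-- A part of a connected set cut off by the vertex `c` is connected together with `c`. -/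
theorem CutConnected.insert_of_cut (hS : T.CutConnected S) {c : V} {U W : Set V}
    (hSeq : S = insert c (U ∪ W)) (hanti : ∀ u ∈ U, ∀ w ∈ W, T.StrongAntiadj u w) :
    T.CutConnected (insert c U) := by
  have hc : c ∈ S := hSeq ▸ Or.inl rfl
  have hsub : insert c U ⊆ S := hSeq ▸ Set.insert_subset_insert Set.subset_union_left
  -- A set avoiding `c` and cut off inside `insert c U` is also cut off in `S`, as only `c` links
  -- `U` to `W`. If `c` is in the given set, this is applied to the complement.
  have closed : ∀ Q ⊆ insert c U, Q.Nonempty → c ∉ Q →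
      (∀ u ∈ Q, ∀ w ∈ insert c U, w ∉ Q → ¬ T.Adj u w) → False := by
    intro Q hQ hne hcQ hcl
    have := hS Q (hQ.trans hsub) hne fun u hu w hw hwQ hadj => by
      rw [hSeq] at hw
      rcases hw with hw | hw | hw
      · exact hcl u hu w (Or.inl hw) hwQ hadj
      · exact hcl u hu w (Or.inr hw) hwQ hadj
      · have huU : u ∈ U := (hQ hu).resolve_left fun h => hcQ (h ▸ hu)
        exact hadj.not_strongAntiadj (hanti u huU w hw)
    exact hcQ (this ▸ hc)
  intro Q hQ hne hcl
  by_cases hcQ : c ∈ Q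
  · by_contra hQne
    refine closed (insert c U \ Q) Set.sdiff_subset ?_ (fun h => h.2 hcQ) ?_
    · rw [Set.nonempty_iff_ne_empty]
      exact fun h => hQne (Set.Subset.antisymm hQ (Set.sdiff_eq_empty.1 h))
    · intro u hu w hw hwQ hadj
      have hwQ' : w ∈ Q := by
        by_contra h
        exact hwQ ⟨hw, h⟩
      exact hcl w hwQ' u hu.1 hu.2 hadj.symm
  · exact (closed Q hQ hne hcQ hcl).elim

/-- In a connected set that is not a clique, two antiadjacent vertices can be deleted, singly and
either together or with a common neighbour in the set. -/
theorem CutConnected.exists_deletable_pair [Finite V] (hS : T.CutConnected S) {x₀ y₀ : V}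
    (hx₀ : x₀ ∈ S) (hy₀ : y₀ ∈ S) (hne : x₀ ≠ y₀) (hxy : ¬ T.Adj x₀ y₀) :
    ∃ x ∈ S, ∃ y ∈ S, T.Antiadj x y ∧ T.CutConnected (S \ {x}) ∧ T.CutConnected (S \ {y}) ∧
      ((T.CutConnected (S \ {x, y}) ∧ ¬ T.Adj x y ∧ (S \ {x, y}).Nonempty) ∨
        ∃ z ∈ S, T.Adj x z ∧ T.Adj z y) := by
  by_cases hcut : ∃ c ∈ S, ¬ T.CutConnected (S \ {c})
  · obtain ⟨c, hc, hcut⟩ := hcut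
    rw [← isConnected_iff_cutConnected] at hcut
    obtain ⟨U, W, hUW, hU, hW, hanti⟩ := exists_cut_of_not_isConnected hcut
    have hcU : c ∉ U := fun h => (hUW ▸ (Or.inl h : c ∈ U ∪ W) : c ∈ S \ {c}).2 rfl
    have hcW : c ∉ W := fun h => (hUW ▸ (Or.inr h : c ∈ U ∪ W) : c ∈ S \ {c}).2 rfl
    have hSeq : S = insert c (U ∪ W) := by
      rw [hUW, Set.insert_sdiff_singleton, Set.insert_eq_of_mem hc]
    have hUc := hS.insert_of_cut hSeq hanti
    have hWc := hS.insert_of_cut (by rw [hSeq, Set.union_comm]) fun u hu w hw => (hanti w hw u hu).symm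
    have hne1 : ∀ U : Set V, U.Nonempty → c ∉ U → insert c U ≠ {c} := by
      rintro U ⟨u, hu⟩ hcU h
      have : u ∈ ({c} : Set V) := h ▸ Or.inr hu
      exact hcU (this ▸ hu)
    -- Around a cut vertex `c`, one non-cut vertex is deleted on each side; the remaining pieces
    -- still contain `c` and are glued there.
    obtain ⟨x, hx, hxc, hUx⟩ := hUc.exists_diff_singleton (Or.inl rfl) (hne1 U hU hcU)
    obtain ⟨y, hy, hyc, hWy⟩ := hWc.exists_diff_singleton (Or.inl rfl) (hne1 W hW hcW)
    replace hx : x ∈ U := hx.resolve_left hxc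
    replace hy : y ∈ W := hy.resolve_left hyc
    have hdisj : ∀ z, z ∈ U → z ∉ W := fun z hz hz' => (hanti z hz z hz').1 rfl
    have hxyanti := hanti x hx y hy
    have e1 : S \ {x} = (insert c U \ {x}) ∪ insert c W := by
      rw [hSeq]; ext z
      grind
    have e2 : S \ {y} = insert c U ∪ (insert c W \ {y}) := by
      rw [hSeq]; ext z
      grind
    have e3 : S \ {x, y} = (insert c U \ {x}) ∪ (insert c W \ {y}) := by
      rw [hSeq]; ext z
      grind
    have hcx : c ∈ insert c U \ {x} := ⟨Or.inl rfl, fun h => hxc h.symm⟩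
    have hcy : c ∈ insert c W \ {y} := ⟨Or.inl rfl, fun h => hyc h.symm⟩
    refine ⟨x, hSeq ▸ Or.inr (Or.inl hx), y, hSeq ▸ Or.inr (Or.inr hy), hxyanti.antiadj, ?_, ?_,
      Or.inl ⟨?_, fun h => h.not_strongAntiadj hxyanti, ⟨c, ?_⟩⟩⟩
    · rw [e1]; exact hUx.union hWc hcx (Or.inl rfl)
    · rw [e2]; exact hUc.union hWy (Or.inl rfl) hcy
    · rw [e3]; exact hUx.union hWy hcx hcy
    · rw [e3]; exact Or.inl hcx
  · push Not at hcut
    -- Without cut vertices, the first three vertices of a path between non-adjacent vertices serve;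
    -- its first and third vertices may form a switchable pair.
    obtain ⟨p, n, hp, h0, hn, hpS⟩ := hS.exists_path hx₀ hy₀
    have hn2 : 2 ≤ n := by
      by_contra h
      rcases (by omega : n = 0 ∨ n = 1) with rfl | rfl
      · exact hne (h0.symm.trans hn)
      · exact hxy (h0 ▸ hn ▸ hp.1 0 one_pos)
    exact ⟨p 0, hpS 0 (by omega), p 2, hpS 2 hn2, hp.2 0 2 (by omega) hn2,
      hcut _ (hpS 0 (by omega)), hcut _ (hpS 2 hn2), Or.inr ⟨p 1, hpS 1 (by omega),
        hp.1 0 (by omega), hp.1 1 (by omega)⟩⟩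

end Connectivity

/-! ### Counting modulo two -/

section Counting

open Classical in
/-- The number modulo two of `i < n` with `P i`. -/
noncomputable def parityCount (P : ℕ → Prop) (n : ℕ) : ZMod 2 :=
  ∑ i ∈ Finset.range n, if P i then 1 else 0

theorem exists_of_parityCount_eq {P : ℕ → Prop} {n : ℕ} (hn : Odd n)
    (h : parityCount P n = n) : ∃ i < n, P i := by
  by_contra! hP
  rw [parityCount, Finset.sum_eq_zero fun i hi => if_neg (hP i (Finset.mem_range.1 hi))] at h
  exact Nat.not_even_iff_odd.2 hn ((ZMod.natCast_eq_zero_iff_even).1 h.symm)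

theorem parityCount_congr {P Q : ℕ → Prop} {n : ℕ} (h : ∀ i < n, (P i ↔ Q i)) :
    parityCount P n = parityCount Q n := by
  classical
  exact Finset.sum_congr rfl fun i hi => if_congr (h i (Finset.mem_range.1 hi)) rfl rfl

theorem parityCount_or_add_and (P Q : ℕ → Prop) (n : ℕ) :
    parityCount (fun i => P i ∨ Q i) n + parityCount (fun i => P i ∧ Q i) n =
      parityCount P n + parityCount Q n := by
  simp only [parityCount, ← Finset.sum_add_distrib]
  refine Finset.sum_congr rfl fun i _ => ?_
  by_cases h : P i <;> by_cases h' : Q i <;> simp [h, h']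

theorem parityCount_of_disjoint {P Q R : ℕ → Prop} {n : ℕ}
    (h : ∀ i < n, (R i ↔ P i ∨ Q i) ∧ ¬ (P i ∧ Q i)) :
    parityCount R n = parityCount P n + parityCount Q n := by
  rw [← parityCount_or_add_and, parityCount_congr fun i hi => (h i hi).1, left_eq_add]
  exact Finset.sum_eq_zero fun i hi => if_neg (h i (Finset.mem_range.1 hi)).2

/-- If consecutive members of `P` are at distance one or at even distance, then the number of pairs
of members at distance one has the parity of the total length. -/
theorem parityCount_consecutive {P : ℕ → Prop} : ∀ n, P 0 → P n →
    (∀ a b, a < b → b ≤ n → P a → P b → (∀ c, a < c → c < b → ¬ P c) →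
      a + 1 = b ∨ Even (b - a)) →
    parityCount (fun i => P i ∧ P (i + 1)) n = n := by
  classical
  intro n
  induction n using Nat.strong_induction_on with
  | _ n ih =>
  intro h0 hn hgap
  rcases Nat.eq_zero_or_pos n with rfl | hpos
  · simp [parityCount]
  -- Induction removes the stretch after the last member before `n`: it either has length one and
  -- contributes one pair, or has even length and contributes none.
  have hPa : P (Nat.findGreatest P (n - 1)) := Nat.findGreatest_spec (Nat.zero_le _) h0
  have hle : Nat.findGreatest P (n - 1) ≤ n - 1 := Nat.findGreatest_le _
  have hmax : ∀ c, Nat.findGreatest P (n - 1) < c → c < n → ¬ P c := fun c hc hcn =>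
    Nat.findGreatest_is_greatest hc (by omega)
  generalize Nat.findGreatest P (n - 1) = a at hPa hle hmax
  have iha := ih a (by omega) h0 hPa fun b c hbc hc => hgap b c hbc (by omega)
  by_cases ha : a + 1 = n
  · subst ha
    rw [parityCount, Finset.sum_range_succ, ← parityCount, iha, if_pos ⟨hPa, hn⟩, Nat.cast_succ]
  · have heven := (hgap a n (by omega) le_rfl hPa hn hmax).resolve_left ha
    have hsum : parityCount (fun i => P i ∧ P (i + 1)) n =
        parityCount (fun i => P i ∧ P (i + 1)) a := by
      refine (Finset.sum_subset (Finset.range_mono (by omega)) fun i hi hia => if_neg ?_).symm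
      rw [Finset.mem_range] at hi hia
      rintro ⟨h1, h2⟩
      by_cases hin : i + 1 = n
      · exact hmax i (by omega) hi h1
      · exact hmax (i + 1) (by omega) (by omega) h2
    rw [hsum, iha]
    obtain ⟨t, ht⟩ := heven
    rw [show n = a + (t + t) by omega, Nat.cast_add, Nat.cast_add t t, CharTwo.add_self_eq_zero,
      add_zero]

end Counting

/-! ### Balanced pairs -/

section Balanced

variable {V : Type u} {T : Trigraph V} {A B C : Set V}

/-- No odd path of length greater than one has its ends in `B` and its interior in `A`. -/
def NoOddPath (T : Trigraph V) (A B : Set V) : Prop :=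
  ∀ (p : ℕ → V) (n : ℕ), T.IsPathSeq p n → Odd n → 1 < n → p 0 ∈ B → p n ∈ B →
    (∀ i, 0 < i → i < n → p i ∈ A) → False

theorem isBalancedPair_iff :
    T.IsBalancedPair A B ↔ T.NoOddPath A B ∧ T.compl.NoOddPath B A := by
  have key : ∀ (T : Trigraph V) (A B : Set V), (∀ (n : ℕ) (p : Fin (n + 1) → V), T.IsPath p →
      Odd n → 1 < n →
      ¬ (p 0 ∈ B ∧ p (Fin.last n) ∈ B ∧ ∀ i, i ≠ 0 → i ≠ Fin.last n → p i ∈ A)) ↔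
      T.NoOddPath A B := by
    intro T A B
    constructor
    · intro h p n hp hodd hn h0 h1 hint
      refine h n _ hp.isPath hodd hn ⟨h0, h1, fun i hi0 hil => hint i ?_ ?_⟩
      · exact Nat.pos_of_ne_zero fun h => hi0 (Fin.ext h)
      · exact lt_of_le_of_ne (by omega) fun h => hil (Fin.ext h)
    · rintro h n p hp hodd hn ⟨h0, h1, hint⟩
      have hval : ∀ i, i ≤ n → ((Fin.ofNat (n + 1) i : Fin (n + 1)) : ℕ) = i := fun i hi => by
        simp [Fin.ofNat, Nat.mod_eq_of_lt (Nat.lt_succ_of_le hi)]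
      refine h _ n hp.isPathSeq hodd hn ?_ ?_ fun i hi0 hi => hint _ ?_ ?_
      · rwa [show Fin.ofNat (n + 1) 0 = 0 from Fin.ext (hval 0 (by omega))]
      · rwa [show Fin.ofNat (n + 1) n = Fin.last n from Fin.ext (hval n le_rfl)]
      · intro h
        have := hval i hi.le
        rw [h, Fin.val_zero] at this
        omega
      · intro h
        have := hval i hi.le
        rw [h, Fin.val_last] at this
        omega
  exact and_congr (key T A B) (key T.compl B A)

theorem NoOddPath.mono {A' B' : Set V} (h : T.NoOddPath A B) (hA : A' ⊆ A) (hB : B' ⊆ B) :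
    T.NoOddPath A' B' := fun p n hp hodd hn h0 h1 hi =>
  h p n hp hodd hn (hB h0) (hB h1) fun i h2 h3 => hA (hi i h2 h3)

theorem IsBalancedPair.mono {A' B' : Set V} (h : T.IsBalancedPair A B) (hA : A' ⊆ A)
    (hB : B' ⊆ B) : T.IsBalancedPair A' B' := by
  rw [isBalancedPair_iff] at h ⊢
  exact ⟨h.1.mono hA hB, h.2.mono hB hA⟩

theorem IsBalancedPair.compl (h : T.IsBalancedPair A B) : T.compl.IsBalancedPair B A := by
  rw [isBalancedPair_iff] at h ⊢
  rw [compl_compl]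
  exact h.symm

theorem isBalancedPair_compl : T.compl.IsBalancedPair B A ↔ T.IsBalancedPair A B :=
  ⟨fun h => compl_compl T ▸ h.compl, IsBalancedPair.compl⟩

end Balanced

/-! ### A Roussel–Rubio lemma for balanced pairs -/

section RousselRubio

variable {V : Type u} {T : Trigraph V} {S : Set V}

/-- `v` is strongly adjacent to all members of `S`. -/
def CompleteTo (T : Trigraph V) (v : V) (S : Set V) : Prop := ∀ b ∈ S, T.StrongAdj v b

theorem CompleteTo.mono {v : V} {S' : Set V} (h : T.CompleteTo v S) (hS : S' ⊆ S) :
    T.CompleteTo v S' := fun b hb => h b (hS hb)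

theorem CompleteTo.antiadj_of_diff {v x : V} (h : T.CompleteTo v (S \ {x}))
    (h' : ¬ T.CompleteTo v S) (hv : v ∉ S) : T.Antiadj v x := by
  unfold CompleteTo at h'
  push Not at h'
  obtain ⟨b, hb, hvb⟩ := h'
  have hbx : b = x := by
    by_contra hbx
    exact hvb (h b ⟨hb, hbx⟩)
  subst hbx
  exact (not_strongAdj_iff (by rintro rfl; exact hv hb)).1 hvb

/-- The case of pairwise antiadjacent members of `S`, for one common neighbour in `S` of
consecutive vertices. -/
theorem parityCount_common_neighbour (hT : T.IsBerge) {I : Set V}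
    (hstab : ∀ s ∈ S, ∀ t ∈ S, s ≠ t → T.Antiadj s t) (hIS : Disjoint I S)
    (hbal : T.NoOddPath I S) {p : ℕ → V} {n : ℕ} (hp : T.IsPathSeq p n) (hn : 3 ≤ n)
    (hI : ∀ i, 0 < i → i < n → p i ∈ I) (h0 : T.CompleteTo (p 0) S) (h1 : T.CompleteTo (p n) S)
    {L : Set V} (hL : L ⊆ S) (hne : L.Nonempty) :
    parityCount (fun i => ∃ s ∈ L, T.StrongAdj (p i) s ∧ T.StrongAdj (p (i + 1)) s) n = n := by
  have hpS : ∀ i, i ≤ n → p i ∉ S := by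
    intro i hi hiS
    rcases Nat.eq_zero_or_pos i with rfl | hi0
    · exact (h0 _ hiS).1 rfl
    · rcases hi.eq_or_lt with rfl | hin
      · exact (h1 _ hiS).1 rfl
      · exact Set.disjoint_left.1 hIS (hI i hi0 hin) hiS
  have hanti : ∀ i, i ≤ n → ∀ s ∈ L, ¬ T.StrongAdj (p i) s → T.Antiadj (p i) s :=
    fun i hi s hs h => (not_strongAdj_iff (by rintro rfl; exact hpS i hi (hL hs))).1 h
  -- Between consecutive vertices with neighbours in `L`, a common neighbour closes the segment to a
  -- hole. Otherwise private neighbours `s`, `t` extend it to a path of length `b - a + 2` with ends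
  -- in `S`, whose interior lies in `I` since the ends of `p` are complete to `S`. Berge or balance
  -- gives the parity, and consecutive indices force the first case.
  have gap : ∀ a b, a < b → b ≤ n → (∃ s ∈ L, T.StrongAdj (p a) s) →
      (∃ s ∈ L, T.StrongAdj (p b) s) → (∀ c, a < c → c < b → ¬ ∃ s ∈ L, T.StrongAdj (p c) s) →
      (∃ s ∈ L, T.StrongAdj (p a) s ∧ T.StrongAdj (p b) s) ∧ (a + 1 = b ∨ Even (b - a)) ∨
      a + 1 ≠ b ∧ Even (b - a) := by
    rintro a b hab hb ⟨s, hs, has⟩ ⟨t, ht, hbt⟩ hc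
    have hpab := hp.shift (a := a) hb
    by_cases hcom : ∃ s ∈ L, T.StrongAdj (p a) s ∧ T.StrongAdj (p b) s
    · refine Or.inl ⟨hcom, ?_⟩
      obtain ⟨s, hs, has, hbs⟩ := hcom
      by_contra! hodd
      refine hT.not_hole (hpab.hole (x := s) (by omega) has.adj ?_ fun i hi0 hi => ?_) ?_
      · rw [show a + (b - a) = b by omega]; exact hbs.adj
      · exact hanti _ (by omega) s hs fun h => hc (a + i) (by omega) (by omega) ⟨s, hs, h⟩
      · have := Nat.not_even_iff_odd.1 hodd.2
        exact this.add_even even_two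
    · push Not at hcom
      have hbs := hcom s hs has
      have hat : ¬ T.StrongAdj (p a) t := fun h => hcom t ht h hbt
      have ha0 : 0 < a := Nat.pos_of_ne_zero fun h => hat (h ▸ h0 t (hL ht))
      have hbn : b < n := lt_of_le_of_ne hb fun h => hbs (h ▸ h1 s (hL hs))
      have hst : s ≠ t := fun h => hbs (h ▸ hbt)
      have heven : Even (b - a) := by
        rw [← Nat.not_odd_iff_even]
        intro hodd
        have hq : T.IsPathSeq _ (b - a + 1) := hpab.reverse.snoc (x := s)
          (by simpa using has.adj) fun i hi => by
            rcases Nat.eq_zero_or_pos i with rfl | hi0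
            · rw [show a + (b - a - 0) = b by omega]
              exact hanti b hb s hs hbs
            · exact hanti _ (by omega) s hs fun h => hc _ (by omega) (by omega) ⟨s, hs, h⟩
        have hq' : T.IsPathSeq _ (b - a + 1 + 1) := hq.reverse.snoc (x := t) (by
            rw [Nat.sub_self, snocSeq_of_le (by omega), show a + (b - a - 0) = b by omega]
            exact hbt.adj) fun i hi => by
          rcases Nat.eq_zero_or_pos i with rfl | hi0
          · rw [snocSeq_of_lt (by omega)]
            exact hstab s (hL hs) t (hL ht) hst
          · rw [snocSeq_of_le (by omega)]
            rcases (by omega : i = 1 ∨ 1 < i) with rfl | hi1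
            · rw [show a + (b - a - (b - a + 1 - 1)) = a by omega]
              exact hanti a (by omega) t ht hat
            · exact hanti _ (by omega) t ht fun h => hc _ (by omega) (by omega) ⟨t, ht, h⟩
        refine hbal _ _ hq' (hodd.add_even even_two) (by omega) ?_ ?_ fun i hi0 hi => ?_
        · rw [snocSeq_of_le (by omega), snocSeq_of_lt (by omega)]; exact hL hs
        · rw [snocSeq_of_lt (by omega)]; exact hL ht
        · rw [snocSeq_of_le (by omega), snocSeq_of_le (by omega)]
          exact hI _ (by omega) (by omega)
      refine Or.inr ⟨fun h => ?_, heven⟩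
      rw [← h, Nat.add_sub_cancel_left] at heven
      exact absurd heven (by decide)
  obtain ⟨s₀, hs₀⟩ := hne
  rw [← parityCount_consecutive (P := fun i => ∃ s ∈ L, T.StrongAdj (p i) s) n
    ⟨s₀, hs₀, h0 s₀ (hL hs₀)⟩ ⟨s₀, hs₀, h1 s₀ (hL hs₀)⟩ fun a b hab hb ha hb' hc =>
      (gap a b hab hb ha hb' hc).elim (·.2) fun h => Or.inr h.2]
  refine parityCount_congr fun i hi => ⟨fun ⟨s, hs, h⟩ => ⟨⟨s, hs, h.1⟩, s, hs, h.2⟩, fun h => ?_⟩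
  rcases gap i (i + 1) (by omega) (by omega) h.1 h.2 (fun c _ _ => by omega) with h | h
  · exact h.1
  · exact (h.1 rfl).elim

/-- The case of pairwise antiadjacent members of `S`. -/
theorem exists_complete_edge_of_stable [Finite V] (hT : T.IsBerge) {I : Set V}
    (hstab : ∀ s ∈ S, ∀ t ∈ S, s ≠ t → T.Antiadj s t) (hSne : S.Nonempty) (hIS : Disjoint I S)
    (hbal : T.NoOddPath I S) {p : ℕ → V} {n : ℕ} (hp : T.IsPathSeq p n) (hn : 3 ≤ n)
    (hodd : Odd n) (hI : ∀ i, 0 < i → i < n → p i ∈ I) (h0 : T.CompleteTo (p 0) S)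
    (h1 : T.CompleteTo (p n) S) :
    ∃ i < n, T.CompleteTo (p i) S ∧ T.CompleteTo (p (i + 1)) S := by
  classical
  -- Inclusion–exclusion: the edges whose common neighbours contain `K` and meet `L` are odd in
  -- number. To add `x` to `K`, the conditions "meets `L`" and "contains `x`" have disjunction
  -- "meets `insert x L`", so all counts but that of the conjunction are known.
  have key : ∀ K : Finset V, ↑K ⊆ S → ∀ L ⊆ S, L.Nonempty → parityCount (fun i =>
      (∀ s ∈ K, T.StrongAdj (p i) s ∧ T.StrongAdj (p (i + 1)) s) ∧
        ∃ s ∈ L, T.StrongAdj (p i) s ∧ T.StrongAdj (p (i + 1)) s) n = n := by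
    intro K
    induction K using Finset.induction_on with
    | empty =>
      intro _ L hL hne
      rw [← parityCount_common_neighbour hT hstab hIS hbal hp hn hI h0 h1 hL hne]
      exact parityCount_congr fun i _ => by simp
    | insert x K hx ih =>
      intro hK L hL hne
      rw [Finset.coe_insert, Set.insert_subset_iff] at hK
      have e1 := ih hK.2 L hL hne
      have e2 := ih hK.2 {x} (Set.singleton_subset_iff.2 hK.1) (Set.singleton_nonempty x)
      have e3 := ih hK.2 (insert x L) (Set.insert_subset hK.1 hL) (Set.insert_nonempty x L)
      have h := parityCount_or_add_and (fun i =>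
        (∀ s ∈ K, T.StrongAdj (p i) s ∧ T.StrongAdj (p (i + 1)) s) ∧
          ∃ s ∈ L, T.StrongAdj (p i) s ∧ T.StrongAdj (p (i + 1)) s) (fun i =>
        (∀ s ∈ K, T.StrongAdj (p i) s ∧ T.StrongAdj (p (i + 1)) s) ∧
          ∃ s ∈ ({x} : Set V), T.StrongAdj (p i) s ∧ T.StrongAdj (p (i + 1)) s) n
      rw [e1, e2, ← parityCount_congr (P := fun i =>
        (∀ s ∈ K, T.StrongAdj (p i) s ∧ T.StrongAdj (p (i + 1)) s) ∧
          ∃ s ∈ insert x L, T.StrongAdj (p i) s ∧ T.StrongAdj (p (i + 1)) s) fun i _ => ?_,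
        e3, add_right_inj] at h
      · rw [← h]
        refine parityCount_congr fun i _ => ?_
        simp only [Finset.forall_mem_insert, Set.mem_singleton_iff, exists_eq_left]
        generalize (∃ s ∈ L, T.StrongAdj (p i) s ∧ T.StrongAdj (p (i + 1)) s) = c
        generalize (∀ s ∈ K, T.StrongAdj (p i) s ∧ T.StrongAdj (p (i + 1)) s) = b
        tauto
      · simp only [Set.exists_mem_insert, Set.mem_singleton_iff, exists_eq_left]
        generalize (∃ s ∈ L, T.StrongAdj (p i) s ∧ T.StrongAdj (p (i + 1)) s) = c
        generalize (∀ s ∈ K, T.StrongAdj (p i) s ∧ T.StrongAdj (p (i + 1)) s) = b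
        tauto
  have hfin : S.Finite := Set.toFinite S
  obtain ⟨i, hi, h, -⟩ := exists_of_parityCount_eq hodd
    (key hfin.toFinset (by simp) S subset_rfl hSne)
  simp only [Set.Finite.mem_toFinset] at h
  exact ⟨i, hi, fun s hs => (h s hs).1, fun s hs => (h s hs).2⟩

section Antipath

variable {r : ℕ → V} {d : ℕ} {x y : V}

/-- An antipath through `S` from `x` to `y`, completed to an antipath from `w` to `u`. -/
theorem exists_antipath_extension (hr : T.compl.IsPathSeq r d) (hx : r 0 = x) (hy : r d = y)
    (hrS : ∀ i ≤ d, r i ∈ S) {u w : V} (hu : T.CompleteTo u (S \ {x})) (hux : T.Antiadj u x)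
    (hw : T.CompleteTo w (S \ {y})) (hwy : T.Antiadj w y) (huw : T.Adj u w) :
    ∃ q : ℕ → V, T.compl.IsPathSeq q (d + 2) ∧ q 0 = w ∧ q (d + 2) = u ∧
      ∀ i, 0 < i → i < d + 2 → q i ∈ S := by
  have h1 : T.compl.IsPathSeq (snocSeq r d w) (d + 1) := hr.snoc
    (compl_adj.2 (hy ▸ hwy.symm)) fun i hi => compl_antiadj.2
      (hw _ ⟨hrS i hi.le, fun h => hr.ne hi le_rfl (h.trans hy.symm)⟩).symm.adj
  have h2 : T.compl.IsPathSeq _ (d + 1 + 1) := h1.reverse.snoc (x := u) (by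
    rw [Nat.sub_self, snocSeq_of_le (by omega), hx]
    exact compl_adj.2 hux.symm) fun i hi => compl_antiadj.2 (by
      rcases Nat.eq_zero_or_pos i with rfl | hi0
      · rw [snocSeq_of_lt (by omega)]; exact huw.symm
      · rw [snocSeq_of_le (by omega)]
        exact (hu _ ⟨hrS _ (by omega), fun h =>
          hr.ne (show 0 < d + 1 - i by omega) (by omega) (hx.trans h.symm)⟩).symm.adj)
  refine ⟨_, h2, ?_, ?_, fun i hi0 hi => ?_⟩
  · rw [snocSeq_of_le (by omega), snocSeq_of_lt (by omega)]
  · rw [snocSeq_of_lt (by omega)]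
  · rw [snocSeq_of_le (by omega), snocSeq_of_le (by omega)]; exact hrS _ (by omega)

/-- Since `w` misses only `y` and `u` misses only `x` in `S`, the antipath from `x` to `y` closes up
through `w` and `u`. -/
theorem exists_antihole_extension (hr : T.compl.IsPathSeq r d) (hd : 1 ≤ d) (hx : r 0 = x)
    (hy : r d = y)
    (hrS : ∀ i ≤ d, r i ∈ S) {u w : V} (hu : T.CompleteTo u (S \ {x})) (hux : T.Antiadj u x)
    (hw : T.CompleteTo w (S \ {y})) (hwy : T.Antiadj w y) (huw : T.Antiadj u w) :
    ∃ q : ℕ → V, T.compl.IsHoleSeq q (d + 3) := by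
  have h1 : T.compl.IsPathSeq (snocSeq r d w) (d + 1) := hr.snoc
    (compl_adj.2 (hy ▸ hwy.symm)) fun i hi => compl_antiadj.2
      (hw _ ⟨hrS i hi.le, fun h => hr.ne hi le_rfl (h.trans hy.symm)⟩).symm.adj
  refine ⟨_, h1.hole (x := u) (by omega) ?_ ?_ fun i hi0 hi => ?_⟩
  · rw [snocSeq_of_le (by omega), hx]; exact compl_adj.2 hux.symm
  · rw [snocSeq_of_lt (by omega)]; exact compl_adj.2 huw.symm
  · rw [snocSeq_of_le (by omega)]
    exact compl_antiadj.2 (hu _ ⟨hrS _ (by omega), fun h =>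
      hr.ne hi0 (by omega) (hx.trans h.symm)⟩).symm.adj

/-- The antipath from `p 2` through `S` to `p 1` closes up through `p 3` and then `p 0`, because the
two ends of `p` are complete to `S`. -/
theorem exists_antihole_of_path_three (hr : T.compl.IsPathSeq r d) (hx : r 0 = x)
    (hy : r d = y) (hrS : ∀ i ≤ d, r i ∈ S) {p : ℕ → V} (hp : T.IsPathSeq p 3)
    (h0 : T.CompleteTo (p 0) S) (h3 : T.CompleteTo (p 3) S)
    (hu : T.CompleteTo (p 1) (S \ {x})) (hux : T.Antiadj (p 1) x)
    (hw : T.CompleteTo (p 2) (S \ {y})) (hwy : T.Antiadj (p 2) y) :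
    ∃ q : ℕ → V, T.compl.IsHoleSeq q (d + 5) := by
  obtain ⟨q, hq, hq0, hq1, hqS⟩ := exists_antipath_extension hr hx hy hrS hu hux hw hwy
    (hp.1 1 (by omega))
  have h1 : T.compl.IsPathSeq _ (d + 2 + 1) := hq.snoc (x := p 3)
    (compl_adj.2 (hq1 ▸ hp.2 1 3 (by omega) le_rfl)) fun i hi => compl_antiadj.2 (by
      rcases Nat.eq_zero_or_pos i with rfl | hi0
      · rw [hq0]; exact hp.1 2 (by omega)
      · exact (h3 _ (hqS i hi0 hi)).symm.adj)
  refine ⟨_, h1.hole (x := p 0) (by omega) ?_ ?_ fun i hi0 hi => compl_antiadj.2 ?_⟩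
  · rw [snocSeq_of_le (by omega), hq0]
    exact compl_adj.2 (hp.2 0 2 (by omega) (by omega)).symm
  · rw [snocSeq_of_lt (by omega)]
    exact compl_adj.2 (hp.2 0 3 (by omega) le_rfl).symm
  · rw [snocSeq_of_le (by omega)]
    rcases (by omega : i = d + 2 ∨ i < d + 2) with rfl | hi2
    · rw [hq1]; exact (hp.1 0 (by omega)).symm
    · exact (h0 _ (hqS i hi0 hi2)).symm.adj

end Antipath

/-- A lemma of Roussel and Rubio, in the form needed for balanced pairs: an odd path with ends
complete to an anticonnected set has an interior vertex complete to this set. -/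
theorem IsPathSeq.eq_one_of_complete_ends [Finite V] (hT : T.IsBerge) {I : Set V} :
    ∀ (k : ℕ) (S : Set V), S.ncard = k → S.Nonempty → T.compl.CutConnected S → Disjoint I S →
    T.IsBalancedPair I S → ∀ (p : ℕ → V) (n : ℕ), T.IsPathSeq p n → Odd n →
    (∀ i, 0 < i → i < n → p i ∈ I) → T.CompleteTo (p 0) S → T.CompleteTo (p n) S →
    (∀ i, 0 < i → i < n → ¬ T.CompleteTo (p i) S) → n = 1 := by
  intro k
  induction k using Nat.strong_induction_on with
  | _ k ih =>
  rintro S rfl hSne hS hIS hbal p n hp hodd hI h0 h1 hint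
  by_contra hn1
  have hn : 3 ≤ n := by
    obtain ⟨m, rfl⟩ := hodd
    omega
  obtain ⟨hbal1, hbal2⟩ := isBalancedPair_iff.1 hbal
  have no_edge : ∀ i < n, T.CompleteTo (p i) S → T.CompleteTo (p (i + 1)) S → False := by
    intro i hi h h'
    rcases Nat.eq_zero_or_pos i with rfl | hi0
    · exact hint 1 (by omega) (by omega) h'
    · exact hint i hi0 hi h
  by_cases hstab : ∀ s ∈ S, ∀ t ∈ S, s ≠ t → T.Antiadj s t
  · obtain ⟨i, hi, h, h'⟩ := exists_complete_edge_of_stable hT hstab hSne hIS hbal1 hp hn hodd hI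
      h0 h1
    exact no_edge i hi h h'
  -- By induction every odd stretch between consecutive `U`-complete vertices is an edge, so the
  -- `U`-complete edges are odd in number.
  have count : ∀ U ⊂ S, U.Nonempty → T.compl.CutConnected U →
      parityCount (fun i => T.CompleteTo (p i) U ∧ T.CompleteTo (p (i + 1)) U) n = n := by
    intro U hU hUne hUc
    refine parityCount_consecutive (P := fun i => T.CompleteTo (p i) U) n (h0.mono hU.1)
      (h1.mono hU.1) fun a b hab hb ha hb' hc => ?_
    by_contra! hodd
    have := ih _ (Set.ncard_lt_ncard hU) U rfl hUne hUc (hIS.mono_right hU.1)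
      (hbal.mono subset_rfl hU.1) (fun i => p (a + i)) (b - a) (hp.shift hb)
      (Nat.not_even_iff_odd.1 hodd.2) (fun i hi0 hi => hI _ (by omega) (by omega)) ha
      (by rwa [show a + (b - a) = b by omega]) fun i hi0 hi => hc _ (by omega) (by omega)
    omega
  push Not at hstab
  obtain ⟨x₀, hx₀, y₀, hy₀, hne, hxy₀⟩ := hstab
  obtain ⟨x, hx, y, hy, hxy, hSx, hSy, hrest⟩ := hS.exists_deletable_pair hx₀ hy₀ hne
    (by rwa [compl_adj])
  have hxney := hxy.ne
  have hpS : ∀ i, 0 < i → i < n → p i ∉ S := fun i hi0 hi h =>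
    Set.disjoint_left.1 hIS (hI i hi0 hi) h
  have hX : ∀ i, 0 < i → i < n → T.CompleteTo (p i) (S \ {x}) → T.Antiadj (p i) x :=
    fun i hi0 hi h => h.antiadj_of_diff (hint i hi0 hi) (hpS i hi0 hi)
  have hY : ∀ i, 0 < i → i < n → T.CompleteTo (p i) (S \ {y}) → T.Antiadj (p i) y :=
    fun i hi0 hi h => h.antiadj_of_diff (hint i hi0 hi) (hpS i hi0 hi)
  have hXY : ∀ i, 0 < i → i < n → T.CompleteTo (p i) (S \ {x}) → ¬ T.CompleteTo (p i) (S \ {y}) :=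
    fun i hi0 hi h h' => (hX i hi0 hi h).not_strongAdj (h' x ⟨hx, hxney⟩)
  have hcx := count (S \ {x}) (Set.sdiff_singleton_ssubset.2 hx) ⟨y, hy, hxney.symm⟩ hSx
  have hcy := count (S \ {y}) (Set.sdiff_singleton_ssubset.2 hy) ⟨x, hx, hxney⟩ hSy
  -- If deleting both `x` and `y` is not known to preserve anticonnectedness, a common antineighbour
  -- gives an antipath of length two, which is even.
  obtain ⟨r, d, hr, hr0, hrd, hrS, hd2, hd⟩ : ∃ (r : ℕ → V) (d : ℕ), T.compl.IsPathSeq r d ∧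
      r 0 = x ∧ r d = y ∧ (∀ i ≤ d, r i ∈ S) ∧ 2 ≤ d ∧
      (Even d ∨ T.compl.CutConnected (S \ {x, y}) ∧ (S \ {x, y}).Nonempty) := by
    rcases hrest with ⟨hc, hnadj, hne⟩ | ⟨z, hz, hxz, hzy⟩
    · obtain ⟨r, d, hr, hr0, hrd, hrS⟩ := hS.exists_path hx hy
      refine ⟨r, d, hr, hr0, hrd, hrS, ?_, Or.inr ⟨hc, hne⟩⟩
      by_contra h
      rcases (by omega : d = 0 ∨ d = 1) with rfl | rfl
      · exact hxney (hr0.symm.trans hrd)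
      · exact hnadj (hr0 ▸ hrd ▸ hr.1 0 one_pos)
    · have hxp : T.compl.IsPathSeq (fun _ => x) 0 := ⟨fun i hi => by omega, fun i j _ _ => by omega⟩
      have hxzp : T.compl.IsPathSeq _ 1 := hxp.snoc hxz fun i hi => by omega
      refine ⟨_, 2, hxzp.snoc (x := y) (by rwa [snocSeq_of_lt one_pos]) fun i hi => ?_, ?_, ?_,
        fun i hi => ?_, le_rfl, Or.inl even_two⟩
      · obtain rfl : i = 0 := by omega
        exact hxy
      · rfl
      · rfl
      · interval_cases i
        exacts [hx, hz, hy]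
  rcases Nat.even_or_odd d with hev | hdodd
  · have key : ∀ s t, 0 < s → s < n → 0 < t → t < n → T.CompleteTo (p s) (S \ {x}) →
        T.CompleteTo (p t) (S \ {y}) → s + 1 = t ∨ t + 1 = s := by
      intro s t hs0 hs ht0 ht hsx hty
      by_contra! hst
      have hne : s ≠ t := fun h => hXY s hs0 hs hsx (h ▸ hty)
      have hanti : T.Antiadj (p s) (p t) := by
        rcases hne.lt_or_gt with h | h
        · exact hp.2 s t (by omega) ht.le
        · exact (hp.2 t s (by omega) hs.le).symm
      obtain ⟨q, hq⟩ := exists_antihole_extension hr (by omega) hr0 hrd hrS hsx (hX s hs0 hs hsx)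
        hty (hY t ht0 ht hty) hanti
      exact hT.compl.not_hole hq (hev.add_odd (by decide))
    obtain ⟨i, hi, hi1, hi2⟩ := exists_of_parityCount_eq hodd hcx
    obtain ⟨j, hj, hj1, hj2⟩ := exists_of_parityCount_eq hodd hcy
    have k1 := fun h1 h2 h3 h4 => key i j h1 h2 h3 h4 hi1 hj1
    have k2 := fun h1 h2 h3 h4 => key i (j + 1) h1 h2 h3 h4 hi1 hj2
    have k3 := fun h1 h2 h3 h4 => key (i + 1) j h1 h2 h3 h4 hi2 hj1
    have k4 := fun h1 h2 h3 h4 => key (i + 1) (j + 1) h1 h2 h3 h4 hi2 hj2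
    obtain ⟨l, hl⟩ := hodd
    -- Take an edge complete to `S \ {x}` and one complete to `S \ {y}`. Any interior end of one
    -- must be next to any interior end of the other, so they are the two end edges of a path of
    -- length three.
    obtain ⟨rfl, hij⟩ : n = 3 ∧ (i = 0 ∧ j = 2 ∨ i = 2 ∧ j = 0) := by
      clear key hcx hcy
      omega
    rcases hij with ⟨rfl, rfl⟩ | ⟨rfl, rfl⟩
    · obtain ⟨q, hq⟩ := exists_antihole_of_path_three hr hr0 hrd hrS hp h0 h1 hi2
        (hX 1 (by omega) (by omega) hi2) hj1 (hY 2 (by omega) (by omega) hj1)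
      exact hT.compl.not_hole hq (hev.add_odd (by decide))
    · obtain ⟨q, hq⟩ := exists_antihole_of_path_three hr hr0 hrd hrS hp.reverse h1 h0 hi1
        (hX 2 (by omega) (by omega) hi1) hj2 (hY 1 (by omega) (by omega) hj2)
      exact hT.compl.not_hole hq (hev.add_odd (by decide))
  · obtain ⟨hc, hne⟩ := hd.resolve_left (Nat.not_even_iff_odd.2 hdodd)
    have hcz := count (S \ {x, y}) ⟨Set.sdiff_subset, fun h => (h hx).2 (Or.inl rfl)⟩ hne hc
    -- An adjacent pair would be joined through `S` by an antipath of odd length `d + 2`, against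
    -- balance.
    have hadj : ∀ s t, 0 < s → s < n → 0 < t → t < n → T.CompleteTo (p s) (S \ {x}) →
        T.CompleteTo (p t) (S \ {y}) → ¬ T.Adj (p s) (p t) := by
      intro s t hs0 hs ht0 ht hsx hty hst
      obtain ⟨q, hq, hq0, hq1, hqS⟩ := exists_antipath_extension hr hr0 hrd hrS hsx
        (hX s hs0 hs hsx) hty (hY t ht0 ht hty) hst
      exact hbal2 q _ hq (hdodd.add_even even_two) (by omega) (hq0 ▸ hI t ht0 ht)
        (hq1 ▸ hI s hs0 hs) hqS
    -- A vertex missing both `x` and `y` would close `r` to an antihole of odd length `d + 2`.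
    have hZ : ∀ i, 0 < i → i < n → T.CompleteTo (p i) (S \ {x, y}) →
        T.CompleteTo (p i) (S \ {x}) ∨ T.CompleteTo (p i) (S \ {y}) := by
      intro i hi0 hi hz
      by_cases hix : T.StrongAdj (p i) x
      · refine Or.inr fun b hb => ?_
        by_cases hbx : b = x
        · exact hbx ▸ hix
        · exact hz b ⟨hb.1, fun h => h.elim hbx hb.2⟩
      by_cases hiy : T.StrongAdj (p i) y
      · refine Or.inl fun b hb => ?_
        by_cases hby : b = y
        · exact hby ▸ hiy
        · exact hz b ⟨hb.1, fun h => h.elim hb.2 hby⟩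
      have hne : ∀ b ∈ S, p i ≠ b := fun b hb h => hpS i hi0 hi (h ▸ hb)
      refine (hT.compl.not_hole (hr.hole (x := p i) hd2 ?_ ?_ fun j hj0 hj => ?_)
        (hdodd.add_even even_two)).elim
      · rw [hr0]; exact compl_adj.2 ((not_strongAdj_iff (hne x hx)).1 hix).symm
      · rw [hrd]; exact compl_adj.2 ((not_strongAdj_iff (hne y hy)).1 hiy).symm
      · refine compl_antiadj.2 (hz _ ⟨hrS j hj.le, ?_⟩).symm.adj
        rintro (h | h)
        · exact hr.ne hj0 hj.le (hr0.trans h.symm)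
        · exact hr.ne hj le_rfl (h.trans hrd.symm)
    -- The edges complete to `S \ {x, y}` split into those complete to `S \ {x}` and those complete
    -- to `S \ {y}`; all three counts have the parity of `n`, so `n` is even.
    have hsum : (n : ZMod 2) = n + n := by
      conv_lhs => rw [← hcz]
      conv_rhs =>
        congr
        · rw [← hcx]
        · rw [← hcy]
      refine parityCount_of_disjoint fun i hi => ?_
      have hXZ : ∀ k, T.CompleteTo (p k) (S \ {x}) → T.CompleteTo (p k) (S \ {x, y}) :=
        fun k h => h.mono fun b hb => ⟨hb.1, fun h => hb.2 (Or.inl h)⟩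
      have hYZ : ∀ k, T.CompleteTo (p k) (S \ {y}) → T.CompleteTo (p k) (S \ {x, y}) :=
        fun k h => h.mono fun b hb => ⟨hb.1, fun h => hb.2 (Or.inr h)⟩
      have hend : ∀ k, T.CompleteTo (p k) S → T.CompleteTo (p k) (S \ {x}) ∧
          T.CompleteTo (p k) (S \ {y}) := fun k h =>
        ⟨h.mono Set.sdiff_subset, h.mono Set.sdiff_subset⟩
      have e0 : i = 0 ∧ 0 < i + 1 ∧ i + 1 < n ∨ 0 < i ∧ i < n ∧ (i + 1 < n ∨ i + 1 = n) := by
        omega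
      have h0' := hend 0 h0
      have h1' := hend n h1
      have a1 := hXY i
      have a2 := hXY (i + 1)
      have a3 := hZ i
      have a4 := hZ (i + 1)
      have a5 := hXZ i
      have a6 := hXZ (i + 1)
      have a7 := hYZ i
      have a8 := hYZ (i + 1)
      have a9 := hp.1 i hi
      have b1 := fun h1 h2 h3 h4 h5 h6 => hadj i (i + 1) h1 h2 h3 h4 h5 h6 a9
      have b2 := fun h1 h2 h3 h4 h5 h6 => hadj (i + 1) i h1 h2 h3 h4 h5 h6 a9.symm
      clear hadj hZ hXY hX hY hXZ hYZ hend hcx hcy hcz ih count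
      rcases e0 with ⟨rfl, e1, e2⟩ | ⟨e1, e2, e3 | rfl⟩
      · simp only [zero_add, h0', e1, e2, forall_const] at *
        grind only
      · simp only [e1, e2, e3, Nat.succ_pos, forall_const] at *
        grind only
      · simp only [h1', e1, e2, forall_const] at *
        grind only
    rw [left_eq_add] at hsum
    exact Nat.not_even_iff_odd.2 hodd (ZMod.natCast_eq_zero_iff_even.1 hsum)

end RousselRubio

/-! ### From partial to full balance of a skew-partition -/

section SkewPartitions

variable {V : Type u} {T : Trigraph V} {A B A₁ A₂ B₁ B₂ C D : Set V}

/-- All pairs between `A` and `B` are strongly adjacent. -/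
def Complete (T : Trigraph V) (A B : Set V) : Prop := ∀ a ∈ A, ∀ b ∈ B, T.StrongAdj a b

/-- All pairs between `A` and `B` are strongly antiadjacent. -/
def Anticomplete (T : Trigraph V) (A B : Set V) : Prop :=
  ∀ a ∈ A, ∀ b ∈ B, T.StrongAntiadj a b

theorem Complete.symm (h : T.Complete A B) : T.Complete B A :=
  fun b hb a ha => (h a ha b hb).symm

theorem Anticomplete.symm (h : T.Anticomplete A B) : T.Anticomplete B A :=
  fun b hb a ha => (h a ha b hb).symm

theorem Complete.compl (h : T.Complete A B) : T.compl.Anticomplete A B :=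
  fun a ha b hb => compl_strongAntiadj.2 (h a ha b hb)

theorem Anticomplete.compl (h : T.Anticomplete A B) : T.compl.Complete A B :=
  fun a ha b hb => compl_strongAdj.2 (h a ha b hb)

/-- The ends of the path are antiadjacent and consecutive interior vertices of the antipath are
antiadjacent, so neither can use both `B₁` and `B₂`. -/
theorem IsBalancedPair.union_right (h₁ : T.IsBalancedPair A B₁) (h₂ : T.IsBalancedPair A B₂)
    (hB : T.Complete B₁ B₂) : T.IsBalancedPair A (B₁ ∪ B₂) := by
  rw [isBalancedPair_iff] at h₁ h₂ ⊢
  constructor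
  · rintro p n hp hodd hn h0 hpn hint
    have hanti := hp.2 0 n (by omega) le_rfl
    rcases h0 with h0 | h0 <;> rcases hpn with hpn | hpn
    · exact h₁.1 p n hp hodd hn h0 hpn hint
    · exact hanti.not_strongAdj (hB _ h0 _ hpn)
    · exact hanti.not_strongAdj (hB _ hpn _ h0).symm
    · exact h₂.1 p n hp hodd hn h0 hpn hint
  · have key : ∀ B₁ B₂ : Set V, T.Complete B₁ B₂ → T.compl.NoOddPath B₁ A →
        ∀ (p : ℕ → V) (n : ℕ), T.compl.IsPathSeq p n → Odd n → 1 < n → p 0 ∈ A → p n ∈ A →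
        (∀ i, 0 < i → i < n → p i ∈ B₁ ∪ B₂) → p 1 ∈ B₁ → False := by
      intro B₁ B₂ hB h₁ p n hp hodd hn h0 hpn hint hp1
      refine h₁ p n hp hodd hn h0 hpn fun i hi0 hi => ?_
      induction i, hi0 using Nat.le_induction with
      | base => exact hp1
      | succ i hi0 ih =>
        exact (hint (i + 1) (by omega) hi).resolve_right fun h =>
          (compl_adj.1 (hp.1 i (by omega))).not_strongAdj (hB _ (ih (by omega)) _ h)
    intro p n hp hodd hn h0 hpn hint
    rcases hint 1 one_pos hn with h | h
    · exact key B₁ B₂ hB h₁.2 p n hp hodd hn h0 hpn hint h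
    · exact key B₂ B₁ hB.symm h₂.2 p n hp hodd hn h0 hpn
        (fun i hi0 hi => (hint i hi0 hi).symm) h

theorem IsBalancedPair.union_left (h₁ : T.IsBalancedPair A₁ B) (h₂ : T.IsBalancedPair A₂ B)
    (hA : T.Anticomplete A₁ A₂) : T.IsBalancedPair (A₁ ∪ A₂) B :=
  isBalancedPair_compl.1 (h₁.compl.union_right h₂.compl hA.compl)

theorem isBalancedPair_singleton_left (x : V) (B : Set V) : T.IsBalancedPair {x} B := by
  refine isBalancedPair_iff.2 ⟨fun p n hp hodd hn _ _ hint => ?_,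
    fun p n hp _ hn h0 hpn _ => hp.ne (by omega) le_rfl (h0.trans hpn.symm)⟩
  have hn3 : n ≠ 2 := by rintro rfl; exact absurd hodd (by decide)
  exact hp.ne (i := 1) (j := 2) (by omega) (by omega)
    ((hint 1 (by omega) (by omega)).trans (hint 2 (by omega) (by omega)).symm)

theorem isBalancedPair_of_anticomplete (h : T.Anticomplete A B) : T.IsBalancedPair A B := by
  refine isBalancedPair_iff.2 ⟨fun p n hp hodd hn h0 _ hint => ?_,
    fun p n hp hodd hn h0 _ hint => ?_⟩
  · exact (hp.1 0 (by omega)).not_strongAntiadj (h _ (hint 1 (by omega) hn) _ h0).symm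
  · have hn3 : n ≠ 2 := by rintro rfl; exact absurd hodd (by decide)
    exact (compl_antiadj.1 (hp.2 0 2 (by omega) (by omega))).not_strongAntiadj
      (h _ h0 _ (hint 2 (by omega) (by omega)))

/-- An odd path violating balance closes to an odd hole through `v`; antipaths are treated in the
complement. -/
theorem isBalancedPair_of_vertex (hT : T.IsBerge) {v : V} (hA : T.Anticomplete {v} A)
    (hB : T.Complete {v} B) : T.IsBalancedPair A B := by
  have key : ∀ (T : Trigraph V), T.IsBerge → ∀ A B : Set V, T.Anticomplete {v} A →
      T.Complete {v} B → T.NoOddPath A B := fun T hT A B hA hB p n hp hodd hn h0 hpn hint =>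
    hT.not_hole (hp.hole (x := v) hn (hB v rfl _ h0).symm.adj (hB v rfl _ hpn).symm.adj
      fun i hi0 hi => (hA v rfl _ (hint i hi0 hi)).symm.antiadj) (hodd.add_even even_two)
  exact isBalancedPair_iff.2 ⟨key T hT A B hA hB, key _ hT.compl B A hB.compl hA.compl⟩

/-- A bad path contradicts the Roussel–Rubio lemma for `B`. The ends of a bad antipath have
antineighbours in `B`, hence are joined by an antipath through `B`: if even it closes an odd
antihole, if odd it violates the balance of `(D, B)`. -/
theorem IsBalancedPair.of_complete [Finite V] (hT : T.IsBerge) (h : T.IsBalancedPair D B)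
    (hDB : Disjoint D B) (hBne : B.Nonempty) (hB : T.compl.CutConnected B)
    (hD : ∀ d ∈ D, ¬ T.CompleteTo d B) (hBC : T.Complete B C) : T.IsBalancedPair D C := by
  have hanti : ∀ d ∈ D, ∃ b ∈ B, T.Antiadj d b := by
    intro d hd
    have := hD d hd
    unfold CompleteTo at this
    push Not at this
    obtain ⟨b, hb, hdb⟩ := this
    exact ⟨b, hb, (not_strongAdj_iff (by rintro rfl; exact Set.disjoint_left.1 hDB hd hb)).1 hdb⟩
  refine isBalancedPair_iff.2 ⟨fun p n hp hodd hn h0 hpn hint => ?_,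
    fun q n hq hodd hn h0 hqn hint => ?_⟩
  · have := IsPathSeq.eq_one_of_complete_ends hT _ B rfl hBne hB hDB h p n hp hodd hint
      (hBC.symm _ h0) (hBC.symm _ hpn) fun i hi0 hi => hD _ (hint i hi0 hi)
    omega
  · obtain ⟨s, hs, h0s⟩ := hanti _ h0
    obtain ⟨t, ht, hnt⟩ := hanti _ hqn
    obtain ⟨r, m, hr, hm, hr0, hrm, hrB⟩ := hB.exists_path_through
      (Set.disjoint_left.1 hDB h0) (Set.disjoint_left.1 hDB hqn) (hq.2 0 n (by omega) le_rfl) hs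
      (compl_adj.2 h0s) ht (compl_adj.2 hnt)
    rcases Nat.even_or_odd m with hev | hmodd
    · exact hT.compl.not_hole (hq.union_hole hr hn hm hr0.symm hrm.symm
        fun i j hi0 hi hj0 hj => compl_antiadj.2
          (hBC _ (hrB j hj0 hj) _ (hint i hi0 hi)).symm.adj) (hodd.add_even hev)
    · exact (isBalancedPair_iff.1 h).2 r m hr hmodd hm (hr0 ▸ h0) (hrm ▸ hqn) hrB

theorem HasBalancedSkewPartition.mk' (hA₁ : A₁.Nonempty) (hA₂ : A₂.Nonempty) (hB₁ : B₁.Nonempty)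
    (hB₂ : B₂.Nonempty) (hAB : IsCompl (A₁ ∪ A₂) (B₁ ∪ B₂)) (hA : T.Anticomplete A₁ A₂)
    (hB : T.Complete B₁ B₂) (h : T.IsBalancedPair (A₁ ∪ A₂) (B₁ ∪ B₂)) :
    T.HasBalancedSkewPartition :=
  ⟨_, _, ⟨hAB, not_isConnected_union hA₁ hA₂ hA, not_isConnected_union hB₁ hB₂ hB.compl⟩, h⟩

theorem HasBalancedSkewPartition.compl (h : T.HasBalancedSkewPartition) :
    T.compl.HasBalancedSkewPartition := by
  obtain ⟨A, B, ⟨hAB, hA, hB⟩, h⟩ := h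
  refine ⟨B, A, ⟨hAB.symm, hB, ?_⟩, h.compl⟩
  unfold IsAnticonnected
  rwa [compl_compl]

theorem hasBalancedSkewPartition_compl :
    T.compl.HasBalancedSkewPartition ↔ T.HasBalancedSkewPartition :=
  ⟨fun h => compl_compl T ▸ h.compl, HasBalancedSkewPartition.compl⟩

/-- A skew-partition with an anticomponent balanced with respect to the other side yields a balanced
skew-partition. -/
theorem hasBalancedSkewPartition_of_anticomponent [Finite V] (hT : T.IsBerge) (hA₁ : A₁.Nonempty)
    (hA₂ : A₂.Nonempty) (hB₁ : B₁.Nonempty) (hB₂ : B₂.Nonempty)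
    (hAB : IsCompl (A₁ ∪ A₂) (B₁ ∪ B₂)) (hA : T.Anticomplete A₁ A₂) (hB : T.Complete B₁ B₂)
    (hconn : T.compl.CutConnected B₁) (h : T.IsBalancedPair (A₁ ∪ A₂) B₁) :
    T.HasBalancedSkewPartition := by
  have hdisj : Disjoint (A₁ ∪ A₂) B₁ := hAB.disjoint.mono_right Set.subset_union_left
  -- Only the vertices not complete to `B₁` stay in `A`, the others join the side of `B₂`. If all
  -- are complete, one vertex is kept so that the part is non-empty.
  have shrink : ∀ A ⊆ A₁ ∪ A₂, A.Nonempty → ∃ D ⊆ A, D.Nonempty ∧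
      (∀ x ∈ A, x ∉ D → T.CompleteTo x B₁) ∧
      ∀ C, T.Complete B₁ C → T.IsBalancedPair D C := by
    intro A hA hne
    by_cases h0 : ∃ x ∈ A, ¬ T.CompleteTo x B₁
    · have hsub : {x ∈ A | ¬ T.CompleteTo x B₁} ⊆ A := fun x hx => hx.1
      refine ⟨{x ∈ A | ¬ T.CompleteTo x B₁}, hsub, h0, fun x hx hxD => ?_, fun C hC => ?_⟩
      · by_contra hc
        exact hxD ⟨hx, hc⟩
      · exact (h.mono (hsub.trans hA) subset_rfl).of_complete hT
          (hdisj.mono_left (hsub.trans hA)) hB₁ hconn (fun d hd => hd.2) hC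
    · push Not at h0
      obtain ⟨z, hz⟩ := hne
      exact ⟨{z}, Set.singleton_subset_iff.2 hz, ⟨z, rfl⟩, fun x hx _ => h0 x hx,
        fun C _ => isBalancedPair_singleton_left z C⟩
  obtain ⟨D₁, hD₁, hne₁, hc₁, hb₁⟩ := shrink A₁ Set.subset_union_left hA₁
  obtain ⟨D₂, hD₂, hne₂, hc₂, hb₂⟩ := shrink A₂ Set.subset_union_right hA₂
  have hD : D₁ ∪ D₂ ⊆ A₁ ∪ A₂ := Set.union_subset_union hD₁ hD₂
  have hDanti : T.Anticomplete D₁ D₂ := fun a ha b hb => hA a (hD₁ ha) b (hD₂ hb)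
  have hcomp : T.Complete B₁ ((D₁ ∪ D₂) ∪ B₁)ᶜ := by
    intro b hb x hx
    simp only [Set.mem_compl_iff, Set.mem_union, not_or] at hx
    have hxu : x ∈ (A₁ ∪ A₂) ∪ (B₁ ∪ B₂) := hAB.sup_eq_top.ge (Set.mem_univ x)
    rcases hxu with (hx' | hx') | (hx' | hx')
    · exact (hc₁ x hx' hx.1.1 b hb).symm
    · exact (hc₂ x hx' hx.1.2 b hb).symm
    · exact (hx.2 hx').elim
    · exact hB b hb x hx'
  refine .mk' hne₁ hne₂ hB₁ (B₂ := ((D₁ ∪ D₂) ∪ B₁)ᶜ) ?_ ?_ hDanti hcomp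
    ((h.mono hD subset_rfl).union_right ((hb₁ _ hcomp).union_left (hb₂ _ hcomp) hDanti) hcomp)
  · obtain ⟨b, hb⟩ := hB₂
    refine ⟨b, ?_⟩
    rintro (hbD | hb₁)
    · exact Set.disjoint_left.1 hAB.disjoint (hD hbD) (Or.inr hb)
    · exact (hB b hb₁ b hb).1 rfl
  · rw [show B₁ ∪ ((D₁ ∪ D₂) ∪ B₁)ᶜ = (D₁ ∪ D₂)ᶜ from ?_]
    · exact isCompl_compl
    · ext x
      have : x ∈ B₁ → x ∉ D₁ ∪ D₂ := fun h h' => Set.disjoint_left.1 hdisj (hD h') h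
      simp only [Set.mem_union, Set.mem_compl_iff] at *
      tauto

theorem hasBalancedSkewPartition_of_component [Finite V] (hT : T.IsBerge) (hA₁ : A₁.Nonempty)
    (hA₂ : A₂.Nonempty) (hB₁ : B₁.Nonempty) (hB₂ : B₂.Nonempty)
    (hAB : IsCompl (A₁ ∪ A₂) (B₁ ∪ B₂)) (hA : T.Anticomplete A₁ A₂) (hB : T.Complete B₁ B₂)
    (hconn : T.CutConnected A₁) (h : T.IsBalancedPair A₁ (B₁ ∪ B₂)) :
    T.HasBalancedSkewPartition :=
  hasBalancedSkewPartition_compl.1 (hasBalancedSkewPartition_of_anticomponent hT.compl hB₁ hB₂ hA₁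
    hA₂ hAB.symm hB.compl hA.compl (by rwa [compl_compl]) h.compl)

/-- A skew-partition with one balanced pair of parts yields a balanced skew-partition. -/
theorem hasBalancedSkewPartition_of_isBalancedPair [Finite V] (hT : T.IsBerge)
    (hA₁ : A₁.Nonempty) (hA₂ : A₂.Nonempty) (hB₁ : B₁.Nonempty) (hB₂ : B₂.Nonempty)
    (hAB : IsCompl (A₁ ∪ A₂) (B₁ ∪ B₂)) (hA : T.Anticomplete A₁ A₂) (hB : T.Complete B₁ B₂)
    (h : T.IsBalancedPair A₁ B₁) : T.HasBalancedSkewPartition := by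
  -- `A₁` is replaced by one of its components; the rest of it joins `A₂`.
  obtain ⟨D, hDA, hDne, hD, hDanti⟩ := exists_component (T := T) hA₁
  have hrest : T.Anticomplete D (A₁ \ D ∪ A₂) := by
    rintro a ha b (hb | hb)
    · exact hDanti a ha b hb
    · exact hA a (hDA ha) b hb
  have hunion : D ∪ (A₁ \ D ∪ A₂) = A₁ ∪ A₂ := by
    rw [← Set.union_assoc, Set.union_sdiff_cancel hDA]
  replace h := h.mono hDA subset_rfl
  have hA₂' : (A₁ \ D ∪ A₂).Nonempty := hA₂.mono Set.subset_union_right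
  rw [← hunion] at hAB
  generalize A₁ \ D ∪ A₂ = E at hrest hAB hA₂'
  clear hunion hDA hDanti hA hA₁ hA₂
  by_cases hanti : T.Anticomplete D B₁
  · obtain ⟨v, hv⟩ := id hB₁
    refine hasBalancedSkewPartition_of_component hT hDne hA₂' hB₁ hB₂ hAB hrest hB hD
      (h.union_right (isBalancedPair_of_vertex hT (v := v) ?_ ?_) hB)
    · rintro _ rfl a ha; exact (hanti a ha _ hv).symm
    · rintro _ rfl b hb; exact hB _ hv b hb
  by_cases h2 : T.Anticomplete D B₂
  · exact hasBalancedSkewPartition_of_component hT hDne hA₂' hB₁ hB₂ hAB hrest hB hD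
      (h.union_right (isBalancedPair_of_anticomplete h2) hB)
  -- The vertices without neighbours in `D` can leave the `B` side and join `E`. What remains of
  -- `B₁` has an anticomponent `K` all of whose vertices have neighbours in `D`; the complement of
  -- `IsBalancedPair.of_complete` then balances `K` against the enlarged `E`.
  set Z := {z | T.Anticomplete D {z}} with hZ
  have hne : ∀ B : Set V, ¬ T.Anticomplete D B → (B \ Z).Nonempty := by
    intro B hB
    by_contra h0
    rw [Set.not_nonempty_iff_eq_empty, Set.sdiff_eq_empty] at h0
    exact hB fun a ha b hb => h0 hb a ha b rfl
  obtain ⟨K, hKB, hKne, hK, hKanti⟩ := exists_component (T := T.compl) (hne B₁ hanti)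
  have hKZ : ∀ b ∈ K, b ∉ Z := fun b hb => (hKB hb).2
  have hKB₁ : K ⊆ B₁ := hKB.trans Set.sdiff_subset
  have hDZ : ∀ a ∈ D, a ∉ Z := fun a ha haZ => (haZ a ha a rfl).1 rfl
  have hDEZ : T.Anticomplete D (E ∪ ((B₁ ∪ B₂) ∩ Z)) := by
    rintro a ha b (hb | hb)
    · exact hrest a ha b hb
    · exact hb.2 a ha b rfl
  have hKD : Disjoint K D := (hAB.disjoint.mono Set.subset_union_left
    (hKB₁.trans Set.subset_union_left)).symm
  have hbal : T.IsBalancedPair (E ∪ ((B₁ ∪ B₂) ∩ Z)) K := by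
    refine isBalancedPair_compl.1 ((h.mono subset_rfl hKB₁).compl.of_complete hT.compl hKD hDne
      (by rwa [compl_compl]) (fun b hb hc => hKZ b hb ?_) hDEZ.compl)
    rintro a ha _ rfl
    exact (compl_strongAdj.1 (hc a ha)).symm
  refine hasBalancedSkewPartition_of_anticomponent (B₂ := ((B₁ ∪ B₂) \ Z) \ K) hT hDne
    (hA₂'.mono Set.subset_union_left) hKne ?_ ?_ hDEZ ?_ hK
    ((h.mono subset_rfl hKB₁).union_left hbal hDEZ)
  · obtain ⟨b, hb, hbZ⟩ := hne B₂ h2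
    exact ⟨b, ⟨Or.inr hb, hbZ⟩, fun hbK => (hB b (hKB₁ hbK) b hb).1 rfl⟩
  · rw [show K ∪ ((B₁ ∪ B₂) \ Z) \ K = (B₁ ∪ B₂) \ Z from Set.union_sdiff_cancel
      fun b hb => ⟨Or.inl (hKB₁ hb), hKZ b hb⟩, ← Set.union_assoc]
    rw [show D ∪ E = (B₁ ∪ B₂)ᶜ from hAB.eq_compl]
    refine IsCompl.of_eq ?_ ?_
    · ext x
      simp only [Set.inf_eq_inter, Set.mem_inter_iff, Set.mem_union, Set.mem_compl_iff,
        Set.mem_sdiff, Set.bot_eq_empty, Set.mem_empty_iff_false]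
      tauto
    · ext x
      simp only [Set.sup_eq_union, Set.mem_union, Set.mem_inter_iff, Set.mem_compl_iff,
        Set.mem_sdiff, Set.top_eq_univ, Set.mem_univ]
      tauto
  · rintro a ha b ⟨⟨hb | hb, hbZ⟩, hbK⟩
    · exact compl_strongAntiadj.1 (hKanti a ha b ⟨⟨hb, hbZ⟩, hbK⟩)
    · exact hB a (hKB₁ ha) b hb

end SkewPartitions

/-! ### Lifting skew-partitions from blocks -/

section Blocks

variable {V : Type u} {M : Type v} {T : Trigraph V} {X : Set V} {K : Trigraph M} {N : M → Set V}

/-- The vertices of `X` that lie in the set `S` of vertices of a block. -/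
def trace (X : Set V) (S : Set (X ⊕ M)) : Set V := {x | ∃ h : x ∈ X, Sum.inl ⟨x, h⟩ ∈ S}

theorem trace_nonempty {S : Set (X ⊕ M)} (hne : S.Nonempty) (hS : ∀ m, Sum.inr m ∉ S) :
    (trace X S).Nonempty := by
  obtain ⟨x | m, h⟩ := hne
  · exact ⟨x, x.2, h⟩
  · exact (hS m h).elim

theorem addMarkers_strongAdj_inl {x y : X} :
    (T.addMarkers X K N).StrongAdj (.inl x) (.inl y) ↔ T.StrongAdj x y := by
  simp [StrongAdj, addMarkers, Subtype.ext_iff]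

theorem addMarkers_strongAntiadj_inl {x y : X} :
    (T.addMarkers X K N).StrongAntiadj (.inl x) (.inl y) ↔ T.StrongAntiadj x y := by
  simp [StrongAntiadj, addMarkers, Subtype.ext_iff]

theorem addMarkers_semiadj_inl {x y : X} :
    (T.addMarkers X K N).Semiadj (.inl x) (.inl y) ↔ T.Semiadj x y := by
  simp [Semiadj, addMarkers, Subtype.ext_iff]

theorem mem_of_addMarkers_strongAdj {x : X} {m : M}
    (h : (T.addMarkers X K N).StrongAdj (.inl x) (.inr m)) : (x : V) ∈ N m := by
  by_contra hx
  simp [StrongAdj, addMarkers, hx] at h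

theorem notMem_of_addMarkers_strongAntiadj {x : X} {m : M}
    (h : (T.addMarkers X K N).StrongAntiadj (.inl x) (.inr m)) : (x : V) ∉ N m := by
  intro hx
  simp [StrongAntiadj, addMarkers, hx] at h

theorem addMarkers_semiadj_inr {m m' : M} :
    (T.addMarkers X K N).Semiadj (.inr m) (.inr m') ↔ K.Semiadj m m' := by
  simp [Semiadj, addMarkers]

theorem addMarkers_strongAdj_inr {m m' : M} :
    (T.addMarkers X K N).StrongAdj (.inr m) (.inr m') ↔ K.StrongAdj m m' := by
  simp [StrongAdj, addMarkers]

theorem compl_addMarkers {K' : Trigraph M} {N' : M → Set V} (hK : K' = K.compl)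
    (hN : ∀ m, ∀ x ∈ X, (x ∈ N' m ↔ x ∉ N m)) :
    (T.addMarkers X K N).compl = T.compl.addMarkers X K' N' := by
  subst hK
  ext x y
  rcases x with x | m <;> rcases y with y | m'
  · rfl
  · by_cases h : (x : V) ∈ N m' <;> simp [compl, addMarkers, hN m' x x.2, h]
  · by_cases h : (y : V) ∈ N m <;> simp [compl, addMarkers, hN m y y.2, h]
  · rfl

theorem isBalancedPair_trace {A B : Set (X ⊕ M)}
    (h : (T.addMarkers X K N).IsBalancedPair A B) :
    T.IsBalancedPair (trace X A) (trace X B) := by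
  classical
  have key : ∀ (T : Trigraph V) (T' : Trigraph (X ⊕ M)) (A B : Set (X ⊕ M)),
      (∀ x y : X, T.Adj x y → T'.Adj (.inl x) (.inl y)) →
      (∀ x y : X, T.Antiadj x y → T'.Antiadj (.inl x) (.inl y)) →
      T'.NoOddPath A B → T.NoOddPath (trace X A) (trace X B) := by
    intro T T' A B hadj hanti h p n hp hodd hn h0 hpn hint
    have hpX : ∀ i, i ≤ n → p i ∈ X := by
      intro i hi
      rcases Nat.eq_zero_or_pos i with rfl | hi0
      · exact h0.1
      rcases hi.eq_or_lt with rfl | hin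
      · exact hpn.1
      · exact (hint i hi0 hin).1
    -- The default value is never reached: all vertices of the path are in `X`.
    let q : ℕ → X ⊕ M := fun i => if hi : p i ∈ X then .inl ⟨p i, hi⟩ else .inl ⟨p 0, h0.1⟩
    have hq : ∀ i (hi : p i ∈ X), q i = .inl ⟨p i, hi⟩ := fun i hi => dif_pos hi
    refine h q n ⟨fun i hi => ?_, fun i j hij hj => ?_⟩ hodd hn ?_ ?_ fun i hi0 hi => ?_
    · rw [hq _ (hpX i hi.le), hq _ (hpX (i + 1) hi)]
      exact hadj _ _ (hp.1 i hi)
    · rw [hq _ (hpX i (by omega)), hq _ (hpX j hj)]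
      exact hanti _ _ (hp.2 i j hij hj)
    · rw [hq _ h0.1]; exact h0.2
    · rw [hq _ hpn.1]; exact hpn.2
    · rw [hq _ (hint i hi0 hi).1]; exact (hint i hi0 hi).2
  have hadj : ∀ x y : X, T.Adj x y → (T.addMarkers X K N).Adj (.inl x) (.inl y) := fun x y h =>
    h.imp addMarkers_strongAdj_inl.2 addMarkers_semiadj_inl.2
  have hanti : ∀ x y : X, T.Antiadj x y → (T.addMarkers X K N).Antiadj (.inl x) (.inl y) :=
    fun x y h => h.imp addMarkers_strongAntiadj_inl.2 addMarkers_semiadj_inl.2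
  rw [isBalancedPair_iff] at h ⊢
  refine ⟨key _ _ A B hadj hanti h.1, key _ _ B A (fun x y h => ?_) (fun x y h => ?_) h.2⟩
  · exact compl_adj.2 (hanti x y (compl_adj.1 h))
  · exact compl_antiadj.2 (hadj x y (compl_antiadj.1 h))

/-- A balanced skew-partition of a block, with a component and an anticomponent that avoid the
markers, extends to the whole trigraph. -/
theorem hasBalancedSkewPartition_of_addMarkers [Finite V] (hT : T.IsBerge)
    {A₁ A₂ B₁ B₂ : Set (X ⊕ M)} (hA₁ : A₁.Nonempty) (hB₁ : B₁.Nonempty)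
    (hAB : IsCompl (A₁ ∪ A₂) (B₁ ∪ B₂)) (hA : (T.addMarkers X K N).Anticomplete A₁ A₂)
    (hB : (T.addMarkers X K N).Complete B₁ B₂)
    (hbal : (T.addMarkers X K N).IsBalancedPair (A₁ ∪ A₂) (B₁ ∪ B₂))
    (hmA : ∀ m, Sum.inr m ∉ A₁) (hmB : ∀ m, Sum.inr m ∉ B₁) {Y : Set V} (hY : Y ⊆ Xᶜ)
    (hA₂ : (trace X A₂ ∪ Xᶜ \ Y).Nonempty) (hB₂ : (trace X B₂ ∪ Y).Nonempty)
    (hAY : T.Anticomplete (trace X A₁) (Xᶜ \ Y)) (hBY : T.Complete (trace X B₁) Y) :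
    T.HasBalancedSkewPartition := by
  refine hasBalancedSkewPartition_of_isBalancedPair hT (trace_nonempty hA₁ hmA) hA₂
    (trace_nonempty hB₁ hmB) hB₂ ?_ ?_ ?_ (isBalancedPair_trace
      (hbal.mono Set.subset_union_left Set.subset_union_left))
  · rw [show trace X B₁ ∪ (trace X B₂ ∪ Y) = (trace X A₁ ∪ (trace X A₂ ∪ Xᶜ \ Y))ᶜ from ?_]
    · exact isCompl_compl
    ext x
    by_cases hx : x ∈ X
    · have hxY : x ∉ Y := fun h => hY h hx
      have := Set.ext_iff.1 hAB.symm.eq_compl (Sum.inl ⟨x, hx⟩)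
      simpa [trace, hx, hxY] using this
    · by_cases hxY : x ∈ Y <;> simp [trace, hx, hxY]
  · rintro a ⟨ha, ha'⟩ b (⟨hb, hb'⟩ | hb)
    · exact addMarkers_strongAntiadj_inl.1 (hA _ ha' _ hb')
    · exact hAY a ⟨ha, ha'⟩ b hb
  · rintro a ⟨ha, ha'⟩ b (⟨hb, hb'⟩ | hb)
    · exact addMarkers_strongAdj_inl.1 (hB _ ha' _ hb')
    · exact hBY a ⟨ha, ha'⟩ b hb

/-- `X` is joined to its complement through the pairs `(A₁, A₂)` and `(B₁, B₂)` only. -/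
structure IsJoin (T : Trigraph V) (X A₁ B₁ A₂ B₂ : Set V) : Prop where
  disjoint₁ : Disjoint A₁ B₁
  disjoint₂ : Disjoint A₂ B₂
  subset_A : A₂ ⊆ Xᶜ
  subset_B : B₂ ⊆ Xᶜ
  nonempty_A : A₂.Nonempty
  nonempty_B : B₂.Nonempty
  complete_A : T.Complete A₁ A₂
  complete_B : T.Complete B₁ B₂
  anti : ∀ x ∈ X, ∀ y ∈ Xᶜ, ¬ (x ∈ A₁ ∧ y ∈ A₂) → ¬ (x ∈ B₁ ∧ y ∈ B₂) → T.StrongAntiadj x y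

theorem IsJoin.swap {A₁ B₁ A₂ B₂ : Set V} (h : T.IsJoin X A₁ B₁ A₂ B₂) :
    T.IsJoin X B₁ A₁ B₂ A₂ :=
  ⟨h.disjoint₁.symm, h.disjoint₂.symm, h.subset_B, h.subset_A, h.nonempty_B, h.nonempty_A,
    h.complete_B, h.complete_A, fun x hx y hy h1 h2 => h.anti x hx y hy h2 h1⟩

theorem IsSplit.isJoin {s : SplitSets V} (h : T.IsSplit X Xᶜ s) :
    T.IsJoin X s.A₁ s.B₁ s.A₂ s.B₂ where
  disjoint₁ := h.disjoint_AB₁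
  disjoint₂ := h.disjoint_AB₂
  subset_A := fun x hx => h.union₂ ▸ Or.inl (Or.inl hx)
  subset_B := fun x hx => h.union₂ ▸ Or.inl (Or.inr hx)
  nonempty_A := h.nonempty_A₂
  nonempty_B := h.nonempty_B₂
  complete_A := h.complete_A
  complete_B := h.complete_B
  anti := by
    intro x hx y hy h1 h2
    refine (not_adj_iff (by rintro rfl; exact hy hx)).1 ?_
    rintro (hadj | hadj)
    · exact (h.no_other x hx y hy hadj).elim h1 h2
    · exact h.no_switchable x hx y hy hadj

variable {A₁ B₁ A₂ B₂ : Set V} {A B : Set (X ⊕ M)} {a b : M}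

theorem exists_anticomplete_parts {W : Type*} {T : Trigraph W} {A : Set W}
    (h : ¬ T.IsConnected A) {c : W} (hc : c ∈ A) :
    ∃ A₁ A₂, A₁ ∪ A₂ = A ∧ A₁.Nonempty ∧ T.Anticomplete A₁ A₂ ∧ c ∈ A₂ := by
  obtain ⟨U, W, rfl, hU, hW, hUW⟩ := exists_cut_of_not_isConnected h
  rcases hc with hc | hc
  · exact ⟨W, U, Set.union_comm W U, hW, Anticomplete.symm hUW, hc⟩
  · exact ⟨U, W, rfl, hU, hUW, hc⟩

theorem exists_complete_parts {W : Type*} {T : Trigraph W} {B : Set W}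
    (h : ¬ T.IsAnticonnected B) {c : W} (hc : c ∈ B) :
    ∃ B₁ B₂, B₁ ∪ B₂ = B ∧ B₁.Nonempty ∧ T.Complete B₁ B₂ ∧ c ∈ B₂ := by
  obtain ⟨B₁, B₂, hB, hne, hB₁₂, hc⟩ := exists_anticomplete_parts h hc
  exact ⟨B₁, B₂, hB, hne, fun a ha b hb => compl_strongAntiadj.1 (hB₁₂ a ha b hb), hc⟩

/-- The case of all markers on the disconnected side. -/
theorem IsJoin.hasBalancedSkewPartition_of_markers_mem [Finite V] (hj : T.IsJoin X A₁ B₁ A₂ B₂)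
    (hT : T.IsBerge) (hNa : N a = A₁) (hNb : N b = B₁)
    (hs : (T.addMarkers X K N).IsSkewPartition A B) (hbal : (T.addMarkers X K N).IsBalancedPair A B)
    (hA : ∀ m, Sum.inr m ∈ A) {c : M} (hc : ∀ m, m ≠ c → K.Semiadj m c) :
    T.HasBalancedSkewPartition := by
  obtain ⟨P, Q, rfl, hP, hPQ, hcQ⟩ := exists_anticomplete_parts hs.not_connected (hA c)
  obtain ⟨P', Q', hB, hP', hQ', hPQ'⟩ := exists_cut_of_not_isConnected hs.not_anticonnected
  have hcomp : (T.addMarkers X K N).Complete P' Q' :=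
    fun a ha b hb => compl_strongAntiadj.1 (hPQ' a ha b hb)
  subst hB
  have hmP : ∀ m, Sum.inr m ∉ P := by
    intro m hm
    -- Every other marker is switchable with `c`, so none is in the part opposite to that of `c`.
    by_cases hmc : m = c
    · exact (hPQ _ hm _ (hmc ▸ hcQ)).1 rfl
    · exact (addMarkers_semiadj_inr.2 (hc m hmc)).adj.not_strongAntiadj (hPQ _ hm _ hcQ)
  have hmQ : ∀ m, Sum.inr m ∈ Q := fun m => (hA m).resolve_left (hmP m)
  have hmB : ∀ m, Sum.inr m ∉ P' ∪ Q' := fun m => Set.disjoint_left.1 hs.partition.disjoint (hA m)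
  obtain ⟨y, hy⟩ := hj.nonempty_A
  refine hasBalancedSkewPartition_of_addMarkers hT (Y := ∅) hP hP' hs.partition hPQ hcomp hbal hmP
    (fun m hm => hmB m (Or.inl hm)) (Set.empty_subset _) ⟨y, Or.inr ⟨hj.subset_A hy, id⟩⟩
    ((trace_nonempty hQ' fun m hm => hmB m (Or.inr hm)).mono Set.subset_union_left) ?_
    fun _ _ _ hb => hb.elim
  rintro x ⟨hx, hxP⟩ z ⟨hz, -⟩
  refine hj.anti x hx z hz (fun h => ?_) fun h => ?_
  · exact notMem_of_addMarkers_strongAntiadj (hPQ _ hxP _ (hmQ a)) (hNa ▸ h.1)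
  · exact notMem_of_addMarkers_strongAntiadj (hPQ _ hxP _ (hmQ b)) (hNb ▸ h.1)

/-- The case of exactly one marker on the anti-disconnected side, attached to one end of the
join. -/
theorem IsJoin.hasBalancedSkewPartition_of_marker_mem [Finite V] (hj : T.IsJoin X A₁ B₁ A₂ B₂)
    (hT : T.IsBerge) (hNa : N a = A₁) (hNb : N b = B₁)
    (hs : (T.addMarkers X K N).IsSkewPartition A B) (hbal : (T.addMarkers X K N).IsBalancedPair A B)
    (hab : a ≠ b) (hA : ∀ m, m ≠ b → Sum.inr m ∈ A) (hb : Sum.inr b ∈ B) {c : M} (hcb : c ≠ b)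
    (hc : ∀ m, m ≠ c → m ≠ b → K.Semiadj m c) : T.HasBalancedSkewPartition := by
  obtain ⟨P, Q, rfl, hP, hPQ, hcQ⟩ := exists_anticomplete_parts hs.not_connected (hA c hcb)
  obtain ⟨P', Q', rfl, hP', hPQ', hbQ'⟩ := exists_complete_parts hs.not_anticonnected hb
  have hdisj := Set.disjoint_left.1 hs.partition.disjoint
  have hmP : ∀ m, Sum.inr m ∉ P := by
    intro m hm
    by_cases hmc : m = c
    · exact (hPQ _ hm _ (hmc ▸ hcQ)).1 rfl
    by_cases hmb : m = b
    · exact hdisj (Or.inl hm) (hmb ▸ hb)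
    · exact (addMarkers_semiadj_inr.2 (hc m hmc hmb)).adj.not_strongAntiadj (hPQ _ hm _ hcQ)
  have haQ : Sum.inr a ∈ Q := (hA a hab).resolve_left (hmP a)
  have hmP' : ∀ m, Sum.inr m ∉ P' := by
    intro m hm
    by_cases hmb : m = b
    · exact (hPQ' _ hm _ (hmb ▸ hbQ')).1 rfl
    · exact hdisj (hA m hmb) (Or.inl hm)
  obtain ⟨y, hy⟩ := hj.nonempty_A
  -- `B₂` takes the place of the marker `b`. As `P` is anticomplete to `a`, it avoids `A₁`, so its
  -- only neighbours outside `X` are in `B₂`; as `P'` is complete to `b`, it lies in `B₁`.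
  refine hasBalancedSkewPartition_of_addMarkers hT (Y := B₂) hP hP' hs.partition hPQ hPQ' hbal hmP
    hmP' hj.subset_B ⟨y, Or.inr ⟨hj.subset_A hy, Set.disjoint_left.1 hj.disjoint₂ hy⟩⟩
    (hj.nonempty_B.mono Set.subset_union_right) ?_ ?_
  · rintro x ⟨hx, hxP⟩ z ⟨hz, hzB⟩
    exact hj.anti x hx z hz (fun h => notMem_of_addMarkers_strongAntiadj (hPQ _ hxP _ haQ)
      (hNa ▸ h.1)) fun h => hzB h.2
  · rintro x ⟨hx, hxP'⟩ z hz
    exact hj.complete_B x (hNb ▸ mem_of_addMarkers_strongAdj (hPQ' _ hxP' _ hbQ')) z hz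

/-- The two markers attached to the ends of the join cannot both be on the anti-disconnected
side. -/
theorem IsJoin.false_of_markers_mem (hj : T.IsJoin X A₁ B₁ A₂ B₂) (hNa : N a = A₁) (hNb : N b = B₁)
    (hs : (T.addMarkers X K N).IsSkewPartition A B) (hab : K.Antiadj a b) (ha : Sum.inr a ∈ B)
    (hb : Sum.inr b ∈ B) (hm : ∀ m, Sum.inr m ∈ B → m = a ∨ m = b) : False := by
  obtain ⟨P, Q, rfl, ⟨y, hy⟩, hPQ, haQ⟩ := exists_complete_parts hs.not_anticonnected ha
  -- Antiadjacent markers are in the same part, so a vertex of the other part would be in both `A₁`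
  -- and `B₁`.
  have hbQ : Sum.inr b ∈ Q := hb.resolve_left fun h =>
    hab.symm.not_strongAdj (addMarkers_strongAdj_inr.1 (hPQ _ h _ haQ))
  rcases y with x | m
  · exact Set.disjoint_left.1 hj.disjoint₁ (hNa ▸ mem_of_addMarkers_strongAdj (hPQ _ hy _ haQ))
      (hNb ▸ mem_of_addMarkers_strongAdj (hPQ _ hy _ hbQ))
  · rcases hm m (Or.inl hy) with rfl | rfl
    · exact (hPQ _ hy _ haQ).1 rfl
    · exact (hPQ _ hy _ hbQ).1 rfl

theorem IsSkewPartition.mem_or {W : Type*} {T : Trigraph W} {A B : Set W}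
    (h : T.IsSkewPartition A B) (x : W) : x ∈ A ∨ x ∈ B :=
  h.partition.sup_eq_top.ge (Set.mem_univ x)

theorem IsSplit.hasBalancedSkewPartition_of_oddBlock [Finite V] {s : SplitSets V}
    (hs : T.IsSplit X Xᶜ s) (hT : T.IsBerge) (h : (T.oddBlock X s).HasBalancedSkewPartition) :
    T.HasBalancedSkewPartition := by
  obtain ⟨A, B, hAB, hbal⟩ := h
  have hj := hs.isJoin
  have hK : ∀ m m' : OddMarker, m ≠ m' → oddMarkers.Semiadj m m' := fun m m' h => ⟨h, rfl⟩
  rcases hAB.mem_or (.inr .a) with ha | ha <;> rcases hAB.mem_or (.inr .b) with hb | hb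
  · exact hj.hasBalancedSkewPartition_of_markers_mem hT rfl rfl hAB hbal (a := .a) (b := .b)
      (fun m => by cases m <;> assumption) (c := .a) fun m h => hK m _ h
  · exact hj.hasBalancedSkewPartition_of_marker_mem hT rfl rfl hAB hbal (a := .a) (b := .b)
      (by simp) (fun m hm => by cases m <;> simp_all) hb (c := .a) (by simp) fun m h _ => hK m _ h
  · exact hj.swap.hasBalancedSkewPartition_of_marker_mem hT rfl rfl hAB hbal (a := .b) (b := .a)
      (by simp) (fun m hm => by cases m <;> simp_all) ha (c := .b) (by simp) fun m h _ => hK m _ h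
  · exact (hj.false_of_markers_mem rfl rfl hAB (a := .a) (b := .b) (hK _ _ (by simp)).antiadj ha hb
      fun m _ => by cases m <;> simp).elim

theorem IsSplit.hasBalancedSkewPartition_of_evenBlock [Finite V] {s : SplitSets V}
    (hs : T.IsSplit X Xᶜ s) (hT : T.IsBerge) (h : (T.evenBlock X s).HasBalancedSkewPartition) :
    T.HasBalancedSkewPartition := by
  obtain ⟨A, B, hAB, hbal⟩ := h
  have hj := hs.isJoin
  have hK : ∀ m : EvenMarker, m ≠ .c → (evenMarkers (-1)).Semiadj m .c :=
    fun m h => ⟨h, by cases m <;> rfl⟩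
  -- The marker `c` has no strong neighbours, so it cannot be in a set that is not anticonnected.
  have hc : Sum.inr EvenMarker.c ∈ A := by
    refine (hAB.mem_or _).resolve_right fun hc => ?_
    obtain ⟨P, Q, rfl, ⟨y, hy⟩, hPQ, hcQ⟩ := exists_complete_parts hAB.not_anticonnected hc
    rcases y with x | m
    · exact mem_of_addMarkers_strongAdj (hPQ _ hy _ hcQ)
    · have := addMarkers_strongAdj_inr.1 (hPQ _ hy _ hcQ)
      exact (hK m this.1).antiadj.not_strongAdj this
  rcases hAB.mem_or (.inr .a) with ha | ha <;> rcases hAB.mem_or (.inr .b) with hb | hb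
  · exact hj.hasBalancedSkewPartition_of_markers_mem hT rfl rfl hAB hbal (a := .a) (b := .b)
      (fun m => by cases m <;> assumption) (c := .c) hK
  · exact hj.hasBalancedSkewPartition_of_marker_mem hT rfl rfl hAB hbal (a := .a) (b := .b)
      (by simp) (fun m hm => by cases m <;> simp_all) hb (c := .c) (by simp) fun m h _ => hK m h
  · exact hj.swap.hasBalancedSkewPartition_of_marker_mem hT rfl rfl hAB hbal (a := .b) (b := .a)
      (by simp) (fun m hm => by cases m <;> simp_all) ha (c := .c) (by simp) fun m h _ => hK m h
  · refine (hj.false_of_markers_mem rfl rfl hAB (a := .a) (b := .b)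
      (StrongAntiadj.antiadj ⟨by simp, rfl⟩) ha hb fun m hm => ?_).elim
    cases m
    · exact Or.inl rfl
    · exact Or.inr rfl
    · exact (Set.disjoint_left.1 hAB.partition.disjoint hc hm).elim

theorem IsSplit.mem_A_or {s : SplitSets V} (hs : T.IsSplit X Xᶜ s) {x : V} (hx : x ∈ X) :
    (x ∈ s.A₁ ↔ x ∉ s.B₁ ∪ s.C₁) ∧ (x ∈ s.B₁ ↔ x ∉ s.A₁ ∪ s.C₁) := by
  have h1 : x ∈ s.A₁ → x ∉ s.B₁ := fun h => Set.disjoint_left.1 hs.disjoint_AB₁ h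
  have h2 : x ∈ s.A₁ → x ∉ s.C₁ := fun h => Set.disjoint_left.1 hs.disjoint_AC₁ h
  have h3 : x ∈ s.B₁ → x ∉ s.C₁ := fun h => Set.disjoint_left.1 hs.disjoint_BC₁ h
  rw [hs.union₁] at hx
  simp only [Set.mem_union] at *
  tauto

/-- Within `X`, the complement of `B₁ ∪ C₁` is `A₁` and that of `A₁ ∪ C₁` is `B₁`. -/
theorem IsSplit.compl_oddComplBlock {s : SplitSets V} (hs : T.compl.IsSplit X Xᶜ s) :
    (T.oddComplBlock X s).compl = T.compl.oddBlock X s := by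
  refine compl_addMarkers ?_ ?_
  · ext m m'
    rfl
  · rintro (_ | _) x hx
    · exact (hs.mem_A_or hx).1
    · exact (hs.mem_A_or hx).2

theorem IsSplit.compl_evenComplBlock {s : SplitSets V} (hs : T.compl.IsSplit X Xᶜ s) :
    (T.evenComplBlock X s).compl = T.compl.evenBlock X s := by
  refine compl_addMarkers ?_ ?_
  · ext m m'
    cases m <;> cases m' <;> rfl
  · rintro (_ | _ | _) x hx
    · exact (hs.mem_A_or hx).1
    · exact (hs.mem_A_or hx).2
    · exact iff_of_false id fun h => h hx

end Blocks

end Trigraph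

open Trigraph in
theorem mainTheorem7 {V : Type u} [Finite V] (T : Trigraph V) (hF : T.IsInF)
    (hT : ¬ T.HasBalancedSkewPartition) (X : Set V) (hX : T.IsFragment X)
    {W : Type u} (TX : Trigraph W) (hTX : T.IsBlock X TX) :
    ¬ TX.HasBalancedSkewPartition := by
  have hT' : ¬ T.compl.HasBalancedSkewPartition := fun h =>
    hT (hasBalancedSkewPartition_compl.1 h)
  cases hTX with
  | odd s hs _ => exact fun h => hT (hs.hasBalancedSkewPartition_of_oddBlock hF.berge h)
  | even s hs _ => exact fun h => hT (hs.hasBalancedSkewPartition_of_evenBlock hF.berge h)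
  | oddCompl s hs _ =>
    exact fun h => hT' (hs.hasBalancedSkewPartition_of_oddBlock hF.berge.compl
      (hs.compl_oddComplBlock ▸ h.compl))
  | evenCompl s hs _ =>
    exact fun h => hT' (hs.hasBalancedSkewPartition_of_evenBlock hF.berge.compl
      (hs.compl_evenComplBlock ▸ h.compl))
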